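/- Let $k \ge 2$ be an integer. Literals are variables $x$ or complemented variables $\bar x$; a clause is a finite set of literals over pairwise distinct variables; a $(\le k)$-CNF formula is a finite set $F$ of clauses, each of size at most $k$; $n$ denotes the number of variables that occur in $F$. $k$-SAT is the following problem: given a $(\le k)$-CNF formula, output an assignment of truth values to its variables under which every clause contains a true literal, or report that there is no such assignment. For every $\varepsilon > 0$ there is a deterministic algorithm (depending on $k$ and $\varepsilon$) that solves $k$-SAT in time $$O^*\!\left(\left(\frac{2(k-1)}{k} + \varepsilon\right)^{n}\right).$$ Here $O^*$ suppresses polynomial factors: for arbitrary (binary) variable names the running time is at most $\left(\frac{2(k-1)}{k}+\varepsilon\right)^{n}$ times a polynomial in the length of the input, and on formulas whose variables are named $0,\dots,n-1$ it is at most $\left(\frac{2(k-1)}{k}+\varepsilon\right)^{n}$ times a polynomial in $n$. Time is counted on a machine with finitely many registers that hold pointers to immutable cons cells, on which following a pointer, creating a pair and testing for nil take one step each. -/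

import Mathlib

namespace KSat

/-! ### Formulas in conjunctive normal form -/

/-- A literal is a variable (a natural number) with a sign: `(i, true)` is the variable `i`,
`(i, false)` is its complement. -/
abbrev Literal : Type := ℕ × Bool

/-- A set of literals over pairwise distinct variables. -/
def IsClause (C : Finset Literal) : Prop :=
  ∀ u ∈ C, ∀ v ∈ C, u.1 = v.1 → u = v

/-- `F` is a `(≤ k)`-CNF formula: a finite set of clauses, each of size at most `k`. -/
def IsKCNF (k : ℕ) (F : Finset (Finset Literal)) : Prop :=
  ∀ C ∈ F, IsClause C ∧ C.card ≤ k

/-- The set of variables that occur in `F`. -/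
def vbl (F : Finset (Finset Literal)) : Finset ℕ :=
  F.biUnion fun C => C.image Prod.fst

/-- The assignment `α` satisfies `F`: every clause contains a literal that is true under `α`.
Only the values of `α` on `vbl F` matter. -/
def Satisfies (α : ℕ → Bool) (F : Finset (Finset Literal)) : Prop :=
  ∀ C ∈ F, ∃ u ∈ C, α u.1 = u.2

/-- The formula has a satisfying assignment. -/
def Satisfiable (F : Finset (Finset Literal)) : Prop :=
  ∃ α : ℕ → Bool, Satisfies α F

/-- `L` lists the formula `F`: it lists the clauses of `F` in some order without repetition, each
of them as a list of its literals in some order without repetition. -/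
def IsListing (L : List (List Literal)) (F : Finset (Finset Literal)) : Prop :=
  (∀ C ∈ L, C.Nodup) ∧ (L.map List.toFinset).Nodup ∧ (L.map List.toFinset).toFinset = F

/-! ### The machine model

Structured imperative programs over cons cells (pure LISP data, the language WHILE): a program has
finitely many registers, each of which holds a pointer to an immutable cell; a cell is `nil` or a
pair of pointers. Following a pointer, allocating a pair and testing for `nil` take one step each,
so the number of steps is, up to a constant factor, that of a pointer machine or a
random access machine. There is no other primitive: no arithmetic, no test for equality of
structures. -/

/-- The data: binary trees of cons cells. -/
inductive Cell : Type
  | nil : Cell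
  | cons : Cell → Cell → Cell

/-- The first component (`nil` for `nil`). -/
def Cell.hd : Cell → Cell
  | .nil => .nil
  | .cons a _ => a

/-- The second component (`nil` for `nil`). -/
def Cell.tl : Cell → Cell
  | .nil => .nil
  | .cons _ b => b

/-- The number of nodes of a tree; for the encoding of an input, the input length. -/
def Cell.size : Cell → ℕ
  | .nil => 1
  | .cons a b => a.size + b.size + 1

/-- Expressions over the registers. -/
inductive Expr : Type
  | reg : ℕ → Expr
  | nil : Expr
  | cons : Expr → Expr → Expr
  | hd : Expr → Expr
  | tl : Expr → Expr

/-- The contents of the registers. -/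
abbrev Store : Type := ℕ → Cell

/-- The value of an expression. -/
def Expr.eval (s : Store) : Expr → Cell
  | .reg i => s i
  | .nil => .nil
  | .cons e f => .cons (e.eval s) (f.eval s)
  | .hd e => (e.eval s).hd
  | .tl e => (e.eval s).tl

/-- The number of steps needed to evaluate an expression: one for each operation. -/
def Expr.cost : Expr → ℕ
  | .reg _ => 1
  | .nil => 1
  | .cons e f => e.cost + f.cost + 1
  | .hd e => e.cost + 1
  | .tl e => e.cost + 1

/-- Programs. Tests are of the form "the value of `e` is not `nil`". -/
inductive Program : Type
  | skip : Program
  | assign : ℕ → Expr → Program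
  | seq : Program → Program → Program
  | ite : Expr → Program → Program → Program
  | loop : Expr → Program → Program

/-- `Exec p s t s'`: started in the store `s`, the program `p` halts after exactly `t` steps in
the store `s'`. -/
inductive Exec : Program → Store → ℕ → Store → Prop
  | skip (s : Store) : Exec .skip s 1 s
  | assign (s : Store) (i : ℕ) (e : Expr) :
      Exec (.assign i e) s (e.cost + 1) (Function.update s i (e.eval s))
  | seq {p q : Program} {s s' s'' : Store} {t t' : ℕ} :
      Exec p s t s' → Exec q s' t' s'' → Exec (.seq p q) s (t + t') s''
  | iteTrue {e : Expr} {p q : Program} {s s' : Store} {t : ℕ} :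
      e.eval s ≠ .nil → Exec p s t s' → Exec (.ite e p q) s (e.cost + 1 + t) s'
  | iteFalse {e : Expr} {p q : Program} {s s' : Store} {t : ℕ} :
      e.eval s = .nil → Exec q s t s' → Exec (.ite e p q) s (e.cost + 1 + t) s'
  | loopTrue {e : Expr} {p : Program} {s s' s'' : Store} {t t' : ℕ} :
      e.eval s ≠ .nil → Exec p s t s' → Exec (.loop e p) s' t' s'' →
      Exec (.loop e p) s (e.cost + 1 + t + t') s''
  | loopFalse {e : Expr} {p : Program} {s : Store} :
      e.eval s = .nil → Exec (.loop e p) s (e.cost + 1) s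

/-- Programs are deterministic: running time and result are determined by the initial store. -/
theorem Exec.deterministic {p : Program} {s s₁ s₂ : Store} {t₁ t₂ : ℕ}
    (h₁ : Exec p s t₁ s₁) (h₂ : Exec p s t₂ s₂) : t₁ = t₂ ∧ s₁ = s₂ := by
  induction h₁ generalizing t₂ s₂ with
  | skip s => cases h₂; exact ⟨rfl, rfl⟩
  | assign s i e => cases h₂; exact ⟨rfl, rfl⟩
  | seq _ _ ih ih' =>
    cases h₂ with
    | seq a b =>
      obtain ⟨rfl, rfl⟩ := ih a
      obtain ⟨rfl, rfl⟩ := ih' b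
      exact ⟨rfl, rfl⟩
  | iteTrue h _ ih =>
    cases h₂ with
    | iteTrue _ a => obtain ⟨rfl, rfl⟩ := ih a; exact ⟨rfl, rfl⟩
    | iteFalse h' _ => exact absurd h' h
  | iteFalse h _ ih =>
    cases h₂ with
    | iteTrue h' _ => exact absurd h h'
    | iteFalse _ a => obtain ⟨rfl, rfl⟩ := ih a; exact ⟨rfl, rfl⟩
  | loopTrue h _ _ ih ih' =>
    cases h₂ with
    | loopTrue _ a b =>
      obtain ⟨rfl, rfl⟩ := ih a
      obtain ⟨rfl, rfl⟩ := ih' b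
      exact ⟨rfl, rfl⟩
    | loopFalse h' => exact absurd h' h
  | loopFalse h =>
    cases h₂ with
    | loopTrue h' _ _ => exact absurd h h'
    | loopFalse _ => exact ⟨rfl, rfl⟩

/-- On input `x` (in register `0`, all other registers being `nil`), the program halts after
exactly `t` steps with output `y` (in register `0`). -/
def Program.Computes (p : Program) (x : Cell) (t : ℕ) (y : Cell) : Prop :=
  ∃ s : Store, Exec p (fun i => if i = 0 then x else .nil) t s ∧ s 0 = y

/-! ### Encoding of inputs and outputs -/

/-- A list, given an encoding of its entries. -/
def encodeList {A : Type} (f : A → Cell) : List A → Cell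
  | [] => .nil
  | a :: l => .cons (f a) (encodeList f l)

/-- A bit. -/
def encodeBit : Bool → Cell
  | false => .nil
  | true => .cons .nil .nil

/-- A literal: its sign and the name of its variable in binary. -/
def encodeLiteral (u : Literal) : Cell :=
  .cons (encodeBit u.2) (encodeList encodeBit (Nat.bits u.1))

/-- A list of clauses. -/
def encodeFormula (L : List (List Literal)) : Cell :=
  encodeList (encodeList encodeLiteral) L

/-- The output `y` is a table of an assignment to the variables of `F` that satisfies `F`: the
table has the entry `(i, α i)` exactly once for each variable `i` of `F`, and no other entries. The
leading `nil` distinguishes an empty table from the answer `nil`. -/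
def IsSolution (F : Finset (Finset Literal)) (y : Cell) : Prop :=
  ∃ α : ℕ → Bool, Satisfies α F ∧ ∃ vs : List ℕ, vs.Nodup ∧ vs.toFinset = vbl F ∧
    y = .cons .nil (encodeList encodeLiteral (vs.map fun i => (i, α i)))

/-- The right answer for `F`: a satisfying assignment if there is one, and `nil` otherwise. -/
def IsAnswer (F : Finset (Finset Literal)) (y : Cell) : Prop :=
  (Satisfiable F → IsSolution F y) ∧ (¬ Satisfiable F → y = .nil)

/-- The program solves `k`-SAT, on every `(≤ k)`-CNF formula. -/
def SolvesKSat (p : Program) (k : ℕ) : Prop :=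
  ∀ (F : Finset (Finset Literal)) (L : List (List Literal)), IsKCNF k F → IsListing L F →
    ∃ (t : ℕ) (y : Cell), p.Computes (encodeFormula L) t y ∧ IsAnswer F y

/-- On every `(≤ k)`-CNF formula, the running time of the program is at most
`poly(input length) * a ^ n`, where `n` is the number of variables of the formula. -/
def RunsInInputLength (p : Program) (k : ℕ) (a : ℝ) : Prop :=
  ∃ C c : ℕ, ∀ (F : Finset (Finset Literal)) (L : List (List Literal)) (t : ℕ) (y : Cell),
    IsKCNF k F → IsListing L F → p.Computes (encodeFormula L) t y →
      (t : ℝ) ≤ C * ((encodeFormula L).size : ℝ) ^ c * a ^ (vbl F).card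

/-- On every `(≤ k)`-CNF formula with variables `0, …, n - 1`, the running time of the program is
at most `poly(n) * a ^ n`. -/
def RunsInNumVars (p : Program) (k : ℕ) (a : ℝ) : Prop :=
  ∃ C c : ℕ, ∀ (n : ℕ) (F : Finset (Finset Literal)) (L : List (List Literal)) (t : ℕ) (y : Cell),
    IsKCNF k F → vbl F = Finset.range n → IsListing L F → p.Computes (encodeFormula L) t y →
      (t : ℝ) ≤ C * ((n : ℝ) + 1) ^ c * a ^ n

end KSat

namespace KSat

/-! ### Encodings and polynomial bounds -/

/-! The algorithm derandomizes Schöning's random walk by covering codes. Fix a satisfying assignment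
`αs`. A binary code with blocks of length `b` and radius `b / k`, applied block by block, supplies
starting assignments, one of which differs from `αs` in at most `b / k` variables per block. A local
search then has to remove this distance at a price of about `k - 1` choices per unit.

Each round of the search takes a maximal set of falsified clauses over disjoint sets of variables.
If it has more than `t` clauses, `αs` selects a true literal in each of the first `t`. A `k`-ary
covering code of length `t` and radius `s` contains a word with at most `s` wrong selections; a
right one lowers the distance by one, a wrong one raises it by at most one, so the round gains `d =
t - 2s` (`setWord_dist`). For `k ≥ 3` and `s = t / k` the code has about `(k - 1) ^ d` words; for `k
= 2` the ratio `s / t` is taken slightly below one half (`exists_inner_code`). If there are at most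
`t` clauses, their variables, at most `k t` in number, are frozen at guessed values, of which there
are only constantly many. By maximality every clause falsified from then on contains a frozen
variable, so at most `k - 1` of its literals are candidates, and the right one gains one unit
(`exists_fixStep`). `exists_rounds` combines the two modes.

Up to polynomial factors, the outer code has `(2 (k - 1) ^ ((k - 1) / k) / k) ^ b` words and the
search costs `(k - 1) ^ (b / k)` choices per block, which multiply to `(2 (k - 1) / k) ^ b`
(`exists_codes`). All code lengths are constants depending on `k` and `ε`, large enough for `ε` to
absorb the polynomial factors, so the codes are part of the program. Their existence follows from
greedy covering (`exists_cover`, `exists_code`).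

On the machine, following one sequence of choices is a composition of list operations, handled by
the closure properties of `Poly`. All branching is moved into one loop, an odometer running through
the product of the option lists (`Poly.exhaustive_search`). -/

/-- A type whose elements are represented by cells. -/
class Enc (A : Type) where
  /-- the representation -/
  enc : A → Cell

open Enc

theorem Cell.size_pos (x : Cell) : 0 < x.size := by cases x <;> simp [Cell.size]

instance : Enc Unit := ⟨fun _ => .nil⟩
instance : Enc Bool := ⟨encodeBit⟩
instance {A : Type} [Enc A] : Enc (List A) := ⟨encodeList enc⟩
instance {A B : Type} [Enc A] [Enc B] : Enc (A × B) := ⟨fun p => .cons (enc p.1) (enc p.2)⟩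
/-- Natural numbers are represented in unary. -/
instance : Enc ℕ := ⟨fun n => enc (List.replicate n ())⟩
instance {A : Type} [Enc A] : Enc (Option A) :=
  ⟨fun o => o.elim .nil fun a => .cons .nil (enc a)⟩

/-- The size of the representation. -/
def sz {A : Type} [Enc A] (a : A) : ℕ := (enc a).size

section Sizes

variable {A B : Type} [Enc A] [Enc B]

theorem sz_pos (a : A) : 0 < sz a := Cell.size_pos _
@[simp] theorem sz_pair (p : A × B) : sz p = sz p.1 + sz p.2 + 1 := rfl
@[simp] theorem sz_nil : sz ([] : List A) = 1 := rfl
@[simp] theorem sz_cons (a : A) (l : List A) : sz (a :: l) = sz a + sz l + 1 := rfl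
@[simp] theorem sz_unit (a : Unit) : sz a = 1 := rfl
@[simp] theorem sz_none : sz (none : Option A) = 1 := rfl
theorem sz_bool (b : Bool) : sz b ≤ 3 := by cases b <;> decide

theorem sz_mem {l : List A} {a : A} (h : a ∈ l) : sz a < sz l := by
  induction l with
  | nil => simp at h
  | cons b l ih =>
    rcases List.mem_cons.1 h with rfl | h
    · simp
    · have := ih h; simp; omega

theorem length_lt_sz (l : List A) : l.length < sz l := by
  induction l with
  | nil => simp
  | cons b l ih => simp; omega

theorem sz_suffix {l m : List A} (h : l <:+ m) : sz l ≤ sz m := by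
  obtain ⟨r, rfl⟩ := h
  induction r with
  | nil => simp
  | cons a r ih => simp at ih ⊢; omega

theorem sz_append (l m : List A) : sz (l ++ m) + 1 = sz l + sz m := by
  induction l with
  | nil => simp [Nat.add_comm]
  | cons a l ih => simp; omega

/-- `g` is bounded by a polynomial in the size of the argument. -/
def PB (g : A → ℕ) : Prop := ∃ c, ∀ a, g a ≤ (sz a + 1) ^ c

theorem PB.mono {g h : A → ℕ} (hg : PB g) (hh : ∀ a, h a ≤ g a) : PB h :=
  let ⟨c, hc⟩ := hg; ⟨c, fun a => (hh a).trans (hc a)⟩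

theorem PB.const (n : ℕ) : PB fun _ : A => n :=
  ⟨n, fun a => Nat.lt_two_pow_self.le.trans
    (Nat.pow_le_pow_left (by have := sz_pos a; omega) _)⟩

theorem PB.size : PB fun a : A => sz a := ⟨1, fun a => by simp⟩

theorem PB.add {g h : A → ℕ} (hg : PB g) (hh : PB h) : PB fun a => g a + h a := by
  obtain ⟨c, hc⟩ := hg
  obtain ⟨d, hd⟩ := hh
  -- The base is at least 2, so one more factor pays for adding two powers.
  refine ⟨c + d + 1, fun a => ?_⟩
  have h2 : 2 ≤ sz a + 1 := by have := sz_pos a; omega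
  have h3 : (sz a + 1) ^ c ≤ (sz a + 1) ^ (c + d) := Nat.pow_le_pow_right (by omega) (by omega)
  have h4 : (sz a + 1) ^ d ≤ (sz a + 1) ^ (c + d) := Nat.pow_le_pow_right (by omega) (by omega)
  have h5 := Nat.mul_le_mul_left ((sz a + 1) ^ (c + d)) h2
  rw [pow_succ]
  have := hc a; have := hd a
  dsimp only
  omega

theorem PB.mul {g h : A → ℕ} (hg : PB g) (hh : PB h) : PB fun a => g a * h a := by
  obtain ⟨c, hc⟩ := hg
  obtain ⟨d, hd⟩ := hh
  exact ⟨c + d, fun a => by rw [pow_add]; exact Nat.mul_le_mul (hc a) (hd a)⟩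

theorem PB.pow {g : A → ℕ} (hg : PB g) (n : ℕ) : PB fun a => g a ^ n := by
  obtain ⟨c, hc⟩ := hg
  exact ⟨c * n, fun a => by rw [pow_mul]; exact Nat.pow_le_pow_left (hc a) _⟩

theorem PB.comp {g : B → ℕ} {f : A → B} (hg : PB g) (hf : PB fun a => sz (f a)) :
    PB fun a => g (f a) := by
  obtain ⟨c, hc⟩ := hg
  exact ((hf.add (.const 1)).pow c).mono fun a => hc (f a)

/-- A polynomially bounded function of pairs is bounded uniformly over the second components of
bounded size. -/
theorem PB.exists_bound {g : A × B → ℕ} {h : A → ℕ} (hg : PB g) (hh : PB h) :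
    ∃ G : A → ℕ, PB G ∧ ∀ a b, sz b ≤ h a → g (a, b) ≤ G a := by
  obtain ⟨c, hc⟩ := hg
  refine ⟨fun a => (sz a + h a + 2) ^ c, ((PB.size.add hh).add (.const 2)).pow c, fun a b hb => ?_⟩
  refine (hc (a, b)).trans (Nat.pow_le_pow_left ?_ _)
  simp; omega

end Sizes

/-! ### Running programs

A program is run on the value in register `0`; it may use register `1` as a stack. -/

/-- Started with `x` in register `0`, the program halts within `T` steps with `y` in register `0`
and register `1` unchanged. -/
def Runs (p : Program) (x y : Cell) (T : ℕ) : Prop :=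
  ∀ s : Store, s 0 = x → ∃ t s', Exec p s t s' ∧ t ≤ T ∧ s' 0 = y ∧ s' 1 = s 1

theorem Runs.mono {p : Program} {x y : Cell} {T T' : ℕ} (h : Runs p x y T) (hT : T ≤ T') :
    Runs p x y T' := fun s hs =>
  let ⟨t, s', h1, h2, h3⟩ := h s hs; ⟨t, s', h1, h2.trans hT, h3⟩

theorem Runs.seq {p q : Program} {x y z : Cell} {T T' : ℕ} (h : Runs p x y T)
    (h' : Runs q y z T') : Runs (.seq p q) x z (T + T') := fun s hs => by
  obtain ⟨t, s', h1, h2, h3, h4⟩ := h s hs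
  obtain ⟨u, s'', k1, k2, k3, k4⟩ := h' s' h3
  exact ⟨_, _, .seq h1 k1, by omega, k3, k4.trans h4⟩

theorem Runs.assign {e : Expr} {x y : Cell} (h : ∀ s : Store, s 0 = x → e.eval s = y) :
    Runs (.assign 0 e) x y (e.cost + 1) := fun s hs =>
  ⟨_, _, .assign s 0 e, le_rfl, by simp [h s hs], by simp⟩

theorem Runs.loop_nil {p : Program} {x : Cell} (h : x.hd = .nil) :
    Runs (.loop (.hd (.reg 0)) p) x x 3 := fun s hs =>
  ⟨_, s, .loopFalse (by simp [Expr.eval, hs, h]), le_rfl, hs, rfl⟩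

theorem Runs.loop_cons {p : Program} {x y z : Cell} {T T' : ℕ} (hx : x.hd ≠ .nil)
    (h : Runs p x y T) (h' : Runs (.loop (.hd (.reg 0)) p) y z T') :
    Runs (.loop (.hd (.reg 0)) p) x z (T + T' + 3) := fun s hs => by
  obtain ⟨t, s', h1, h2, h3, h4⟩ := h s hs
  obtain ⟨u, s'', k1, k2, k3, k4⟩ := h' s' h3
  exact ⟨_, _, .loopTrue (by simpa [Expr.eval, hs] using hx) h1 k1, by simp [Expr.cost]; omega, k3,
    k4.trans h4⟩

theorem Exec.assign_eq {s s' : Store} {i t : ℕ} {e : Expr} (ht : t = e.cost + 1)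
    (h : s' = Function.update s i (e.eval s)) : Exec (.assign i e) s t s' := by
  subst ht h; exact .assign s i e

/-- The program that runs `p` and `q` on the same value and pairs the results. -/
def Program.pair (p q : Program) : Program :=
  .seq (.assign 1 (.cons (.reg 0) (.reg 1))) <| .seq p <|
  .seq (.assign 1 (.cons (.reg 0) (.reg 1))) <| .seq (.assign 0 (.hd (.tl (.reg 1)))) <|
  .seq (.assign 1 (.cons (.hd (.reg 1)) (.tl (.tl (.reg 1))))) <| .seq q <|
  .seq (.assign 0 (.cons (.hd (.reg 1)) (.reg 0))) (.assign 1 (.tl (.reg 1)))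

theorem Runs.pair {p q : Program} {x y z : Cell} {T T' : ℕ} (h : Runs p x y T)
    (h' : Runs q x z T') : Runs (p.pair q) x (.cons y z) (T + T' + 28) := fun s hs => by
  obtain ⟨t, s', h1, h2, h3, h4⟩ := h (Function.update s 1 (.cons x (s 1))) (by simpa using hs)
  obtain ⟨u, s'', k1, k2, k3, k4⟩ := h'
    (Function.update (Function.update s' 0 x) 1 (.cons y (s 1))) (by simp)
  have e1 : Exec (.assign 1 (.cons (.reg 0) (.reg 1))) s 4
      (Function.update s 1 (.cons x (s 1))) := .assign_eq rfl (by simp [Expr.eval, hs])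
  have e2 : Exec (.assign 1 (.cons (.reg 0) (.reg 1))) s' 4
      (Function.update s' 1 (.cons y (.cons x (s 1)))) := .assign_eq rfl (by simp [Expr.eval, h3, h4])
  have e3 : Exec (.assign 0 (.hd (.tl (.reg 1)))) (Function.update s' 1 (.cons y (.cons x (s 1)))) 4
      (Function.update (Function.update s' 1 (.cons y (.cons x (s 1)))) 0 x) :=
    .assign_eq rfl (by simp [Expr.eval, Cell.hd, Cell.tl])
  have e4 : Exec (.assign 1 (.cons (.hd (.reg 1)) (.tl (.tl (.reg 1)))))
      (Function.update (Function.update s' 1 (.cons y (.cons x (s 1)))) 0 x) 7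
      (Function.update (Function.update s' 0 x) 1 (.cons y (s 1))) := .assign_eq rfl <| by
    funext i
    by_cases h0 : i = 0 <;> by_cases h1 : i = 1 <;>
      simp_all [Expr.eval, Cell.hd, Cell.tl, Function.update_apply]
  have e5 : Exec (.assign 0 (.cons (.hd (.reg 1)) (.reg 0))) s'' 5
      (Function.update s'' 0 (.cons y z)) := .assign_eq rfl (by simp [Expr.eval, k3, k4, Cell.hd])
  have e6 : Exec (.assign 1 (.tl (.reg 1))) (Function.update s'' 0 (.cons y z)) 3
      (Function.update (Function.update s'' 0 (.cons y z)) 1 (s 1)) :=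
    .assign_eq rfl (by simp [Expr.eval, k4, Cell.tl])
  exact ⟨_, _, .seq e1 (.seq h1 (.seq e2 (.seq e3 (.seq e4 (.seq k1 (.seq e5 e6)))))), by omega,
    by simp, by simp⟩

/-- The program that runs `q` or `r` on the given value, depending on the result of `p`. -/
def Program.cond (p q r : Program) : Program :=
  .seq (.assign 1 (.cons (.reg 0) (.reg 1))) <| .seq p <|
  .ite (.reg 0)
    (.seq (.assign 0 (.hd (.reg 1))) (.seq (.assign 1 (.tl (.reg 1))) q))
    (.seq (.assign 0 (.hd (.reg 1))) (.seq (.assign 1 (.tl (.reg 1))) r))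

theorem Runs.cond {p q r : Program} {x y z : Cell} {T T' : ℕ} (h : Runs p x y T)
    (hq : y ≠ .nil → Runs q x z T') (hr : y = .nil → Runs r x z T') :
    Runs (p.cond q r) x z (T + T' + 12) := fun s hs => by
  obtain ⟨t, s', h1, h2, h3, h4⟩ := h (Function.update s 1 (.cons x (s 1))) (by simpa using hs)
  have e1 : Exec (.assign 1 (.cons (.reg 0) (.reg 1))) s 4
      (Function.update s 1 (.cons x (s 1))) := .assign_eq rfl (by simp [Expr.eval, hs])
  have e2 : Exec (.assign 0 (.hd (.reg 1))) s' 3 (Function.update s' 0 x) :=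
    .assign_eq rfl (by simp [Expr.eval, h4, Cell.hd])
  have e3 : Exec (.assign 1 (.tl (.reg 1))) (Function.update s' 0 x) 3
      (Function.update (Function.update s' 0 x) 1 (s 1)) :=
    .assign_eq rfl (by simp [Expr.eval, h4, Cell.tl])
  by_cases hy : y = .nil
  · obtain ⟨u, s'', k1, k2, k3, k4⟩ := hr hy
      (Function.update (Function.update s' 0 x) 1 (s 1)) (by simp)
    refine ⟨_, _, .seq e1 <| .seq h1 <| .iteFalse ?_ <| .seq e2 <| .seq e3 k1, ?_, k3, by simp [k4]⟩
    · simp [Expr.eval, h3, hy]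
    · simp [Expr.cost]; omega
  · obtain ⟨u, s'', k1, k2, k3, k4⟩ := hq hy
      (Function.update (Function.update s' 0 x) 1 (s 1)) (by simp)
    refine ⟨_, _, .seq e1 <| .seq h1 <| .iteTrue ?_ <| .seq e2 <| .seq e3 k1, ?_, k3, by simp [k4]⟩
    · simpa [Expr.eval, h3] using hy
    · simp [Expr.cost]; omega

theorem Runs.ite {e : Expr} {p q : Program} {x y : Cell} {T : ℕ}
    (hp : ∀ s : Store, s 0 = x → e.eval s ≠ .nil → Runs p x y T)
    (hq : ∀ s : Store, s 0 = x → e.eval s = .nil → Runs q x y T) :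
    Runs (.ite e p q) x y (e.cost + 1 + T) := fun s hs => by
  by_cases h : e.eval s = .nil
  · obtain ⟨u, s'', k1, k2, k3, k4⟩ := hq s hs h s hs
    exact ⟨_, _, .iteFalse h k1, by omega, k3, k4⟩
  · obtain ⟨u, s'', k1, k2, k3, k4⟩ := hp s hs h s hs
    exact ⟨_, _, .iteTrue h k1, by omega, k3, k4⟩

/-! ### Polynomial-time functions -/

/-- A function that a program computes in polynomial time, with outputs of polynomial size. -/
def Poly {A B : Type} [Enc A] [Enc B] (f : A → B) : Prop :=
  ∃ (p : Program) (T : A → ℕ), PB T ∧ (PB fun a => sz (f a)) ∧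
    ∀ a, Runs p (enc a) (enc (f a)) (T a)

/-- An expression that evaluates to a given cell. -/
def Cell.quote : Cell → Expr
  | .nil => .nil
  | .cons x y => .cons x.quote y.quote

theorem Cell.eval_quote (x : Cell) (s : Store) : x.quote.eval s = x := by
  induction x with
  | nil => rfl
  | cons x y hx hy => simp [Cell.quote, Expr.eval, hx, hy]

/-- Case distinction on a list. -/
def caseList {E B : Type} (l : List E) (n : B) (c : E → List E → B) : B :=
  match l with
  | [] => n
  | e :: r => c e r

@[simp] theorem caseList_nil {E B : Type} (n : B) (c : E → List E → B) : caseList [] n c = n := rfl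
@[simp] theorem caseList_cons {E B : Type} (e : E) (r : List E) (n : B) (c : E → List E → B) :
    caseList (e :: r) n c = c e r := rfl

namespace Poly

variable {A B D E S : Type} [Enc A] [Enc B] [Enc D] [Enc E] [Enc S]

theorem size {f : A → B} (h : Poly f) : PB fun a => sz (f a) := let ⟨_, _, _, h, _⟩ := h; h

theorem of_expr {f : A → B} (e : Expr) (hs : PB fun a => sz (f a))
    (h : ∀ (s : Store) (a : A), s 0 = enc a → e.eval s = enc (f a)) : Poly f :=
  ⟨.assign 0 e, fun _ => e.cost + 1, .const _, hs, fun a => Runs.assign fun s hs => h s a hs⟩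

/-- Functions that do not change the representation. -/
theorem cast {f : A → B} (h : ∀ a, enc (f a) = enc a) : Poly f :=
  of_expr (.reg 0) (PB.size.mono fun a => by simp [sz, h]) fun s a hs => by simp [Expr.eval, h, hs]

theorem id : Poly fun a : A => a := cast fun _ => rfl

theorem const (b : B) : Poly fun _ : A => b :=
  of_expr (enc b).quote (.const _) fun s _ _ => Cell.eval_quote _ s

theorem fst : Poly fun p : A × B => p.1 :=
  of_expr (.hd (.reg 0)) (PB.size.mono fun p => by simp; omega) fun s p hs => by
    simp [Expr.eval, hs, enc, Cell.hd]

theorem snd : Poly fun p : A × B => p.2 :=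
  of_expr (.tl (.reg 0)) (PB.size.mono fun p => by simp; omega) fun s p hs => by
    simp [Expr.eval, hs, enc, Cell.tl]

theorem comp {g : B → D} {f : A → B} (hg : Poly g) (hf : Poly f) : Poly fun a => g (f a) := by
  obtain ⟨p, T, h1, h2, h3⟩ := hf
  obtain ⟨q, U, k1, k2, k3⟩ := hg
  exact ⟨.seq p q, fun a => T a + U (f a), h1.add (k1.comp h2), k2.comp h2,
    fun a => (h3 a).seq (k3 _)⟩

theorem pair {f : A → B} {g : A → D} (hf : Poly f) (hg : Poly g) : Poly fun a => (f a, g a) := by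
  obtain ⟨p, T, h1, h2, h3⟩ := hf
  obtain ⟨q, U, k1, k2, k3⟩ := hg
  exact ⟨p.pair q, fun a => T a + U a + 28, (h1.add k1).add (.const _), (h2.add k2).add (.const 1),
    fun a => (h3 a).pair (k3 a)⟩

theorem ite {c : A → Bool} {f g : A → B} (hc : Poly c) (hf : Poly f) (hg : Poly g) :
    Poly fun a => if c a then f a else g a := by
  obtain ⟨p, T, h1, -, h3⟩ := hc
  obtain ⟨q, U, k1, k2, k3⟩ := hf
  obtain ⟨r, V, l1, l2, l3⟩ := hg
  refine ⟨p.cond q r, fun a => T a + (U a + V a) + 12, (h1.add (k1.add l1)).add (.const _),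
    (k2.add l2).mono fun a => by cases h : c a <;> simp [h], fun a => (h3 a).cond ?_ ?_⟩
  · intro h
    cases hca : c a
    · simp [hca, enc, encodeBit] at h
    · simpa [hca] using (k3 a).mono (Nat.le_add_right _ _)
  · intro h
    cases hca : c a
    · simpa [hca] using (l3 a).mono (Nat.le_add_left _ _)
    · simp [hca, enc, encodeBit] at h

theorem nil : Poly fun _ : A => ([] : List E) := const _

theorem cons {f : A → E} {g : A → List E} (hf : Poly f) (hg : Poly g) :
    Poly fun a => f a :: g a :=
  -- A nonempty list and the pair of its head and tail are the same cell.
  (cast (f := fun p : E × List E => p.1 :: p.2) fun _ => rfl).comp (hf.pair hg)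

theorem some {f : A → B} (hf : Poly f) : Poly fun a => some (f a) :=
  (cast (f := fun p : Unit × B => Option.some p.2) fun _ => rfl).comp ((const ()).pair hf)

/-- With `(l a, a)` in the register, the same cell also reads as `((e, r), a)` or as `((), a)`,
depending on whether the list is empty. A test of the first component therefore suffices to enter
the right branch with its data in place. -/
theorem caseList {l : A → List E} {n : A → B} {c : A × E × List E → B} (hl : Poly l) (hn : Poly n)
    (hc : Poly c) : Poly fun a => caseList (l a) (n a) fun e r => c (a, e, r) := by
  obtain ⟨p, T, h1, h2, h3⟩ := hl.pair id
  obtain ⟨q, U, k1, k2, k3⟩ := hc.comp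
    (snd.pair fst : Poly fun x : (E × List E) × A => (x.2, x.1))
  obtain ⟨r, V, l1, l2, l3⟩ := hn.comp (snd : Poly fun x : Unit × A => x.2)
  obtain ⟨c1, hc1⟩ := k1
  obtain ⟨c2, hc2⟩ := l1
  have hs := hl.size
  refine ⟨.seq p (.ite (.hd (.reg 0)) q r), fun a => T a + (3 + ((sz (l a) + sz a + 2) ^ c1
    + (sz a + 3) ^ c2)), ?_, ?_, fun a => (h3 a).seq ?_⟩
  · exact h1.add ((PB.const 3).add ((((hs.add .size).add (.const 2)).pow _).add
      ((PB.size.add (.const 3)).pow _)))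
  · obtain ⟨d, hd⟩ := hc.size
    refine (((((PB.size (A := A)).add hs).add (.const 2)).pow d).add hn.size).mono fun a => ?_
    cases hla : l a with
    | nil => simp [hla]
    | cons e r =>
      have := hd (a, e, r)
      simp only [sz_pair, hla, caseList_cons, sz_cons] at this ⊢
      refine this.trans (le_trans (Nat.pow_le_pow_left ?_ _) (Nat.le_add_right _ _)); omega
  · dsimp only
    cases hla : l a with
    | nil =>
      refine Runs.ite (e := .hd (.reg 0)) (fun s hs h => absurd ?_ h) fun s hs h =>
        (l3 ((), a)).mono ?_
      · simp [Expr.eval, hs, enc, encodeList, Cell.hd]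
      · have := hc2 ((), a)
        simp only [sz_pair, sz_unit] at this
        refine this.trans (le_trans (Nat.pow_le_pow_left ?_ _) (Nat.le_add_left _ _)); omega
    | cons e r =>
      refine Runs.ite (e := .hd (.reg 0)) (fun s hs h => (k3 ((e, r), a)).mono ?_)
        (fun s hs h => absurd h ?_)
      · have := hc1 ((e, r), a)
        simp only [sz_pair, sz_cons] at this ⊢
        refine this.trans (le_trans (Nat.pow_le_pow_left ?_ _) (Nat.le_add_right _ _)); omega
      · simp [Expr.eval, hs, enc, encodeList, Cell.hd]

theorem foldl_runs {p : Program} {T : ℕ} {f : A → S → E → S} (a : A) (l : List E) (s : S)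
    (h : ∀ l' e r, l = l' ++ e :: r → Runs p (enc (e :: r, (l'.foldl (f a) s, a)))
      (enc (r, (f a (l'.foldl (f a) s) e, a))) T) :
    Runs (.loop (.hd (.reg 0)) p) (enc (l, (s, a))) (enc (([] : List E), (l.foldl (f a) s, a)))
      (l.length * (T + 3) + 3) := by
  induction l generalizing s with
  | nil => simpa using Runs.loop_nil rfl
  | cons e r ih =>
    refine (Runs.loop_cons ?_ (h [] e r rfl) (ih (f a s e) fun l' e' r' hr => ?_)).mono ?_
    · simp [enc, encodeList, Cell.hd]
    · simpa using h (e :: l') e' r' (by simp [hr])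
    · simp; ring_nf; omega

/-- The loop carries the remaining list, the accumulator and the parameter. A polynomial-time step
alone would allow the accumulator to grow exponentially under iteration; hence the uniform bound `G`
over all prefixes. -/
theorem foldl {l : A → List E} {i : A → S} {f : A × S × E → S} (hl : Poly l) (hi : Poly i)
    (hf : Poly f) {G : A → ℕ} (hG : PB G)
    (hs : ∀ a l', l' <+: l a → sz (l'.foldl (fun s e => f (a, s, e)) (i a)) ≤ G a) :
    Poly fun a => (l a).foldl (fun s e => f (a, s, e)) (i a) := by
  obtain ⟨p, T, h1, -, h3⟩ := hl.pair (hi.pair id)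
  obtain ⟨q, U, ⟨c, hc⟩, -, k3⟩ := (snd.comp fst).pair ((hf.comp ((snd.comp snd).pair
    ((fst.comp snd).pair (fst.comp fst)))).pair (snd.comp snd) :
      Poly fun x : (E × List E) × (S × A) => (f (x.2.2, x.2.1, x.1.1), x.2.2))
  obtain ⟨r, V, ⟨d, hd⟩, -, l3⟩ := (fst.comp snd : Poly fun x : List E × S × A => x.2.1)
  have hs' := hl.size
  refine ⟨.seq p (.seq (.loop (.hd (.reg 0)) q) r), fun a =>
    T a + ((sz (l a) * ((sz (l a) + (G a + sz a) + 3) ^ c + 3) + 3) + (G a + sz a + 4) ^ d),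
    ?_, hG.mono fun a => hs a _ (List.prefix_refl _), fun a => (h3 a).seq (.seq
      (y := enc (([] : List E), ((l a).foldl (fun s e => f (a, s, e)) (i a), a))) ?_ ?_)⟩
  · exact h1.add (((hs'.mul (((((hs'.add (hG.add .size)).add (.const 3)).pow _)).add
      (.const 3))).add (.const 3)).add (((hG.add .size).add (.const 4)).pow _))
  · refine (foldl_runs (f := fun a s e => f (a, s, e)) a (l a) (i a)
      (T := (sz (l a) + (G a + sz a) + 3) ^ c) fun l' e r hr => ?_).mono ?_
    · refine (k3 ((e, r), (_, a))).mono ((hc _).trans (Nat.pow_le_pow_left ?_ _))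
      have h1 := hs a l' ⟨_, hr.symm⟩
      have h2 : sz (e :: r) ≤ sz (l a) := sz_suffix ⟨_, hr.symm⟩
      simp only [sz_pair, sz_cons] at h2 ⊢
      omega
    · gcongr
      exact (length_lt_sz _).le
  · refine (l3 ([], _, a)).mono ((hd _).trans (Nat.pow_le_pow_left ?_ _))
    have h1 := hs a _ (List.prefix_refl _)
    simp only [sz_pair, sz_nil]
    omega

/-- A fold, each step of which increases a measure of the state by a bounded amount only. -/
theorem foldl_of_measure {l : A → List E} {i : A → S} {f : A × S × E → S} (hl : Poly l)
    (hi : Poly i) (hf : Poly f) {G : A → ℕ} (hG : PB G) (m : S → ℕ) (h1 : ∀ s, sz s ≤ m s)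
    (h2 : PB fun a => m (i a)) (h3 : ∀ a s, ∀ e ∈ l a, m (f (a, s, e)) ≤ m s + G a) :
    Poly fun a => (l a).foldl (fun s e => f (a, s, e)) (i a) := by
  refine foldl hl hi hf (h2.add (hl.size.mul hG)) fun a l' hl' => (h1 _).trans ?_
  have key : ∀ (r : List E) (s : S), (∀ e ∈ r, e ∈ l a) →
      m (r.foldl (fun s e => f (a, s, e)) s) ≤ m s + r.length * G a := by
    intro r
    induction r with
    | nil => intro s _; simp
    | cons e r ih =>
      intro s h
      have h1 := ih (f (a, s, e)) fun e' he' => h e' (by simp [he'])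
      have h2 := h3 a s e (h e (by simp))
      simp only [List.foldl_cons, List.length_cons, add_mul]
      omega
  refine (key l' (i a) fun e he => hl'.subset he).trans ?_
  have := length_lt_sz (l a)
  have := hl'.length_le
  gcongr
  omega

theorem foldl_of_add {l : A → List E} {i : A → S} {f : A × S × E → S} (hl : Poly l) (hi : Poly i)
    (hf : Poly f) {G : A → ℕ} (hG : PB G)
    (hs : ∀ a s, ∀ e ∈ l a, sz (f (a, s, e)) ≤ sz s + G a) :
    Poly fun a => (l a).foldl (fun s e => f (a, s, e)) (i a) :=
  foldl_of_measure hl hi hf hG sz (fun _ => le_rfl) hi.size hs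

/-! ### List operations in polynomial time -/

theorem reverse {l : A → List E} (hl : Poly l) : Poly fun a => (l a).reverse := by
  have := foldl_of_add (f := fun x : A × List E × E => x.2.2 :: x.2.1) (i := fun _ => []) hl nil
    ((snd.comp snd).cons (fst.comp snd)) (hl.size) fun a s e he => by
      have := sz_mem he
      simp; omega
  convert this using 2
  rw [← List.foldr_reverse]
  simp

theorem exists_bound {l : A → List E} {f : A × E → B} (hl : Poly l) (hf : Poly f) :
    ∃ G : A → ℕ, PB G ∧ ∀ a, ∀ e ∈ l a, sz (f (a, e)) ≤ G a := by
  obtain ⟨G, h1, h2⟩ := hf.size.exists_bound hl.size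
  exact ⟨G, h1, fun a e he => h2 a e (sz_mem he).le⟩

theorem map {l : A → List E} {f : A × E → B} (hl : Poly l) (hf : Poly f) :
    Poly fun a => (l a).map fun e => f (a, e) := by
  obtain ⟨G, h1, h2⟩ := exists_bound hl hf
  have := reverse (foldl_of_add (f := fun x : A × List B × E => f (x.1, x.2.2) :: x.2.1)
    (i := fun _ => []) hl nil ((hf.comp (fst.pair (snd.comp snd))).cons (fst.comp snd))
    (h1.add (.const 1)) fun a s e he => by
      have := h2 a e he
      simp; omega)
  convert this using 2 with a
  have h : ∀ s : List B, (l a).foldl (fun s e => f (a, e) :: s) s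
      = ((l a).map fun e => f (a, e)).reverse ++ s := by
    induction l a with
    | nil => simp
    | cons e m ih => intro s; simp [ih]
  rw [h]; simp

theorem filter {l : A → List E} {f : A × E → Bool} (hl : Poly l) (hf : Poly f) :
    Poly fun a => (l a).filter fun e => f (a, e) := by
  have := reverse (foldl_of_add
    (f := fun x : A × List E × E => if f (x.1, x.2.2) then x.2.2 :: x.2.1 else x.2.1)
    (i := fun _ => []) hl nil (ite (hf.comp (fst.pair (snd.comp snd)))
      ((snd.comp snd).cons (fst.comp snd)) (fst.comp snd))
    hl.size fun a s e he => by
      have := sz_mem he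
      dsimp only
      split <;> (simp; try omega))
  convert this using 2 with a
  rw [← List.foldr_reverse, eq_comm, List.reverse_eq_iff, ← List.filter_reverse]
  generalize (l a).reverse = m
  induction m with
  | nil => rfl
  | cons e m ih => rw [List.foldr_cons, ih, List.filter_cons]

theorem not {f : A → Bool} (hf : Poly f) : Poly fun a => !f a := by
  convert ite hf (const false) (const true) using 2 with a
  cases f a <;> rfl

theorem and {f g : A → Bool} (hf : Poly f) (hg : Poly g) : Poly fun a => f a && g a := by
  convert ite hf hg (const false) using 2 with a
  cases f a <;> rfl

theorem all {l : A → List E} {f : A × E → Bool} (hl : Poly l) (hf : Poly f) :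
    Poly fun a => (l a).all fun e => f (a, e) := by
  have := foldl_of_add (f := fun x : A × Bool × E => x.2.1 && f (x.1, x.2.2))
    (i := fun _ => true) hl (const _) (and (fst.comp snd) (hf.comp (fst.pair (snd.comp snd))))
    (.const 3) fun a s e he => (sz_bool _).trans (by omega)
  convert this using 2 with a
  have h : ∀ b, (l a).foldl (fun s e => s && f (a, e)) b = (b && (l a).all fun e => f (a, e)) := by
    induction l a with
    | nil => simp
    | cons e m ih => intro b; rw [List.foldl_cons, ih, List.all_cons, Bool.and_assoc]
  rw [h]; simp

theorem any {l : A → List E} {f : A × E → Bool} (hl : Poly l) (hf : Poly f) :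
    Poly fun a => (l a).any fun e => f (a, e) := by
  have := not (all hl (not hf))
  convert this using 2 with a
  simp [List.any_eq_not_all_not]

theorem isEmpty {l : A → List E} (hl : Poly l) : Poly fun a => (l a).isEmpty := by
  convert caseList hl (const true) (const (A := A × E × List E) false) using 2 with a
  cases l a <;> rfl

theorem append {l m : A → List E} (hl : Poly l) (hm : Poly m) : Poly fun a => l a ++ m a := by
  have := foldl_of_add (f := fun x : A × List E × E => x.2.2 :: x.2.1) (reverse hl) hm
    ((snd.comp snd).cons (fst.comp snd)) (reverse hl).size fun a s e he => by
      have := sz_mem he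
      simp; omega
  convert this using 2
  rw [List.foldl_reverse]
  simp

theorem flatten {l : A → List (List E)} (hl : Poly l) : Poly fun a => (l a).flatten := by
  have := foldl_of_add (f := fun x : A × List E × List E => x.2.1 ++ x.2.2) (i := fun _ => []) hl nil
    ((fst.comp snd).append (snd.comp snd)) (hl.size) fun a s e he => by
      have := sz_mem he
      have := sz_append s e
      dsimp only; omega
  convert this using 2 with a
  have h : ∀ s : List E, (l a).foldl (fun s e => s ++ e) s = s ++ (l a).flatten := by
    induction l a with
    | nil => simp
    | cons e m ih => intro s; simp [ih]
  rw [h]; simp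

theorem tail {l : A → List E} (hl : Poly l) : Poly fun a => (l a).tail := by
  convert caseList hl nil (snd.comp snd) using 2 with a
  cases l a <;> rfl

/-- Numbers are unary, so this is a fold of `tail` over a list of `n a` units. -/
theorem drop {n : A → ℕ} {l : A → List E} (hn : Poly n) (hl : Poly l) :
    Poly fun a => (l a).drop (n a) := by
  have hr : Poly fun a => List.replicate (n a) () :=
    (cast (f := fun n : ℕ => List.replicate n ()) fun _ => rfl).comp hn
  have := foldl_of_add (f := fun x : A × List E × Unit => x.2.1.tail) hr hl
    (tail (fst.comp snd)) (.const 0) fun a s e he => sz_suffix (List.tail_suffix _)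
  convert this using 2 with a
  generalize l a = m
  induction n a generalizing m with
  | zero => simp
  | succ k ih => rw [List.replicate_succ, List.foldl_cons, ← ih, List.drop_tail]

theorem zip {l : A → List E} {m : A → List D} (hl : Poly l) (hm : Poly m) :
    Poly fun a => (l a).zip (m a) := by
  have h1 : Poly fun x : A × (List D × List (E × D)) × E =>
      KSat.caseList x.2.1.1 x.2.1 fun d r => (r, (x.2.2, d) :: x.2.1.2) :=
    caseList (c := fun y : (A × (List D × List (E × D)) × E) × D × List D =>
      (y.2.2, (y.1.2.2, y.2.1) :: y.1.2.1.2)) (fst.comp (fst.comp snd)) (fst.comp snd)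
      ((snd.comp snd).pair (((snd.comp (snd.comp fst)).pair (fst.comp snd)).cons
        (snd.comp (fst.comp (snd.comp fst)))))
  have := (snd.comp (foldl_of_add (i := fun a => (m a, [])) hl (hm.pair nil) h1
    (hl.size.add (.const 2)) fun a s e he => by
      have := sz_mem he
      obtain ⟨s1, s2⟩ := s
      cases s1
      · simp
      · simp; omega)).reverse
  convert this using 2 with a
  have h : ∀ (m : List D) (r : List (E × D)), ((l a).foldl (fun s e =>
      KSat.caseList s.1 s fun d r => (r, (e, d) :: s.2)) (m, r)).2 = ((l a).zip m).reverse ++ r := by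
    induction l a with
    | nil => simp
    | cons e l ih =>
      intro m r
      cases m with
      | nil => simpa using ih [] r
      | cons d m => simp [ih]
  rw [h]; simp

theorem bool_beq {f g : A → Bool} (hf : Poly f) (hg : Poly g) : Poly fun a => f a == g a := by
  convert ite hf hg (not hg) using 2 with a
  cases f a <;> cases g a <;> rfl

/-- The machine cannot compare structures. The fold runs along `f a` and keeps the unread part of `g
a` with a flag, which becomes false at a mismatch or if `g a` ends early; finally `g a` must be used
up. -/
theorem bits_beq {f g : A → List Bool} (hf : Poly f) (hg : Poly g) :
    Poly fun a => f a == g a := by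
  have h1 : Poly fun x : A × (List Bool × Bool) × Bool =>
      KSat.caseList x.2.1.1 ([], false) fun d r => (r, x.2.1.2 && x.2.2 == d) :=
    caseList (c := fun y : (A × (List Bool × Bool) × Bool) × Bool × List Bool =>
      (y.2.2, y.1.2.1.2 && y.1.2.2 == y.2.1)) (fst.comp (fst.comp snd)) (const _)
      ((snd.comp snd).pair (and (snd.comp (fst.comp (snd.comp fst)))
        (bool_beq (snd.comp (snd.comp fst)) (fst.comp snd))))
  have h2 := foldl_of_add (i := fun a => (g a, true)) hf (hg.pair (const _)) h1
    (.const 6) fun a s e he => by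
      obtain ⟨s1, s2⟩ := s
      cases s1
      · have := sz_bool false
        simp; omega
      · rename_i d r
        have := sz_bool (s2 && e == d)
        simp only [caseList_cons, sz_pair, sz_cons]; omega
  convert and (snd.comp h2) (isEmpty (fst.comp h2)) using 2 with a
  generalize g a = m
  have h : ∀ (m : List Bool) (b : Bool), let z := ((f a).foldl (fun s e =>
      KSat.caseList s.1 ([], false) fun d r => (r, s.2 && e == d)) (m, b))
      (z.2 && z.1.isEmpty) = (b && f a == m) := by
    induction f a with
    | nil => intro m b; cases m <;> simp
    | cons e l ih =>
      intro m b
      cases m with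
      | nil =>
        have := ih [] false
        simp only [Bool.false_and] at this
        simp only [List.foldl_cons, caseList_nil]
        rw [this]; simp
      | cons d m =>
        simp only [List.foldl_cons, caseList_cons]
        rw [ih]
        simp [Bool.and_assoc]
  rw [h]; simp

theorem bits_eq {f g : A → List Bool} (hf : Poly f) (hg : Poly g) :
    Poly fun a => decide (f a = g a) := by
  convert bits_beq hf hg using 2 with a
  rw [Bool.eq_iff_iff]; simp

end Poly

/-! ### The algorithm

A literal is a pair of a sign and a variable; an assignment is the list of its true literals. -/

section Algorithm

variable {X : Type} [DecidableEq X]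

/-- The literal `u` is true under `T`. -/
def holds (T : List (Bool × X)) (u : Bool × X) : Bool := T.any fun e => e.1 == u.1 && decide (e.2 = u.2)

/-- The clause `C` is falsified by `T`. -/
def falsified (T C : List (Bool × X)) : Bool := C.all fun u => !holds T u

/-- The variable `x` belongs to `Z`. -/
def memVar (Z : List X) (x : X) : Bool := Z.any fun y => decide (y = x)

/-- Make `u` true. -/
def setLit (T : List (Bool × X)) (u : Bool × X) : List (Bool × X) :=
  T.map fun e => if decide (e.2 = u.2) then u else e

/-- Make a list of literals true, one after the other. -/
def setLits (T us : List (Bool × X)) : List (Bool × X) := us.foldl setLit T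

/-- The variables of a list of clauses. -/
def varsOf (G : List (List (Bool × X))) : List X := G.flatten.map Prod.snd

/-- A maximal list of falsified clauses over pairwise disjoint sets of variables. -/
def packing (F : List (List (Bool × X))) (T : List (Bool × X)) : List (List (Bool × X)) :=
  F.foldl (fun G C => if falsified T C && C.all fun u => !memVar (varsOf G) u.2
    then C :: G else G) []

/-- Make the `j`-th literal of `C` true. -/
def setNth (T C : List (Bool × X)) (j : ℕ) : List (Bool × X) :=
  caseList (C.drop j) T fun u _ => setLit T u

/-- In each clause of `G`, make the literal that the word `w` selects true. -/
def setWord (T : List (Bool × X)) (G : List (List (Bool × X))) (w : List ℕ) : List (Bool × X) :=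
  (G.zip w).foldl (fun T p => setNth T p.1 p.2) T

/-- Make the `j`-th free literal of `C` true, and freeze its variable. -/
def fixLit (st : List (Bool × X) × List X) (C : List (Bool × X)) (j : ℕ) :
    List (Bool × X) × List X :=
  caseList ((C.filter fun u => !memVar st.2 u.2).drop j) st fun u _ =>
    (setLit st.1 u, u.2 :: st.2)

/-- Make the `j`-th free literal of some falsified clause true, and freeze its variable. -/
def fixStep (F : List (List (Bool × X))) (st : List (Bool × X) × List X) (j : ℕ) :
    List (Bool × X) × List X :=
  caseList (F.filter fun C => falsified st.1 C) st fun C _ => fixLit st C j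

/-- If there are at most `t` clauses in the packing, freeze its variables to the values `β`. -/
def freeze (t : ℕ) (F : List (List (Bool × X))) (β : List Bool)
    (st : Bool × List (Bool × X) × List X) : Bool × List (Bool × X) × List X :=
  if st.1 then st else
  if ((packing F st.2.1).drop t).isEmpty then
    (true, setLits st.2.1 (β.zip (varsOf (packing F st.2.1))), varsOf (packing F st.2.1))
  else st

/-- One round of the local search, in one of two modes. -/
def round (t : ℕ) (F : List (List (Bool × X))) (β : List Bool)
    (st : Bool × List (Bool × X) × List X) (w : List ℕ) : Bool × List (Bool × X) × List X :=
  if (freeze t F β st).1 then (true, w.foldl (fixStep F) (freeze t F β st).2) else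
  (false, setWord (freeze t F β st).2.1 (packing F (freeze t F β st).2.1) w,
    (freeze t F β st).2.2)

/-- The final assignment of the local search along a sequence of choices. -/
def walk (t : ℕ) (F : List (List (Bool × X))) (vs : List X) (β : List Bool)
    (r : List (List Bool × List (List ℕ))) : List (Bool × X) :=
  (((r.map Prod.snd).flatten).foldl (round t F β)
    (false, setLits (vs.map fun x => (false, x)) (((r.map Prod.fst).flatten).zip vs), [])).2.1

/-- The local search along the sequence of choices `σ`. -/
def search (t : ℕ) (F : List (List (Bool × X))) (vs : List X)
    (σ : List (List Bool × List (List ℕ))) : Option (List (Bool × X)) :=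
  -- Of the first entry only the guess for the frozen variables is used. Each later entry belongs to
  -- one block of variables: its start word and the words of its rounds.
  caseList σ none fun B r =>
    if F.all fun C => !falsified (walk t F vs B.1 r) C then some (walk t F vs B.1 r) else none

/-- The list of all variables, without repetition. -/
def dedupVars (F : List (List (Bool × X))) : List X :=
  (varsOf F).foldl (fun vs x => if memVar vs x then vs else x :: vs) []

end Algorithm

/-- The size of a table, with all signs replaced by the larger sign. -/
def tableSize {X : Type} [Enc X] (T : List (Bool × X)) : ℕ := sz (T.map fun e => (true, e.2))

/-! ### Size bounds for the states of the local search -/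

section Sizes

variable {X : Type} [Enc X]

theorem sz_le_tableSize (T : List (Bool × X)) : sz T ≤ tableSize T := by
  unfold tableSize
  induction T with
  | nil => simp
  | cons e T ih =>
    have h1 := sz_bool e.1
    have h2 : sz true = 3 := rfl
    simp only [sz_cons, sz_pair, List.map_cons]; omega

theorem tableSize_le (T : List (Bool × X)) : tableSize T ≤ 3 * sz T := by
  unfold tableSize
  induction T with
  | nil => simp
  | cons e T ih =>
    have h1 := sz_pos e.1
    have h2 : sz true = 3 := rfl
    simp only [sz_cons, sz_pair, List.map_cons]; omega

/-- An entry is only replaced by one with the same variable. `sz` itself may grow, because `true`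
has a larger code than `false`; `tableSize` is therefore the measure that gives polynomial bounds
for long folds. -/
theorem tableSize_setLit [DecidableEq X] (T : List (Bool × X)) (u : Bool × X) :
    tableSize (setLit T u) = tableSize T := by
  unfold tableSize setLit
  rw [List.map_map]
  congr 2
  funext e
  by_cases h : e.2 = u.2 <;> simp [h]

theorem tableSize_setLits [DecidableEq X] (T us : List (Bool × X)) :
    tableSize (setLits T us) = tableSize T := by
  unfold setLits
  induction us generalizing T with
  | nil => rfl
  | cons u us ih => rw [List.foldl_cons, ih, tableSize_setLit]

theorem tableSize_setNth [DecidableEq X] (T C : List (Bool × X)) (j : ℕ) :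
    tableSize (setNth T C j) = tableSize T := by
  unfold setNth
  cases C.drop j <;> simp [tableSize_setLit]

theorem tableSize_setWord [DecidableEq X] (T : List (Bool × X)) (G : List (List (Bool × X)))
    (w : List ℕ) : tableSize (setWord T G w) = tableSize T := by
  unfold setWord
  induction G.zip w generalizing T with
  | nil => rfl
  | cons u us ih => rw [List.foldl_cons, ih, tableSize_setNth]

theorem sz_varsOf (G : List (List (Bool × X))) : sz (varsOf G) ≤ sz G := by
  unfold varsOf
  induction G with
  | nil => simp
  | cons C G ih =>
    have h := sz_append (C.map Prod.snd) (G.flatten.map Prod.snd)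
    have h2 : sz (C.map Prod.snd) ≤ sz C := by
      clear ih h
      induction C with
      | nil => simp
      | cons u C ih => simp; omega
    simp only [List.flatten_cons, List.map_append, sz_cons]; omega

theorem sz_packing [DecidableEq X] (F : List (List (Bool × X))) (T : List (Bool × X)) :
    sz (packing F T) ≤ sz F := by
  have h : ∀ G, sz (F.foldl (fun G C => if falsified T C && C.all fun u => !memVar (varsOf G) u.2
      then C :: G else G) G) + 1 ≤ sz G + sz F := by
    induction F with
    | nil => simp
    | cons C F ih =>
      intro G
      rw [List.foldl_cons]
      refine (ih _).trans ?_
      split <;> (simp; omega)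
  have := h []
  simp only [sz_nil] at this
  unfold packing; omega

end Sizes

/-! ### The algorithm runs in polynomial time for each sequence of choices -/

namespace Poly

/-- The names of the variables. -/
abbrev Name := List Bool

variable {A : Type} [Enc A]

theorem p2 {B D : Type} [Enc B] [Enc D] : Poly fun x : A × B × D => x.2.1 := fst.comp snd
theorem p3 {B D : Type} [Enc B] [Enc D] : Poly fun x : A × B × D => x.2.2 := snd.comp snd

variable {T C us : A → List (Bool × Name)} {u : A → Bool × Name} {F G : A → List (List (Bool × Name))}
  {Z : A → List Name} {x : A → Name} {j : A → ℕ} {w : A → List ℕ}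

theorem holds (hT : Poly T) (hu : Poly u) : Poly fun a => holds (T a) (u a) :=
  any (f := fun y : A × Bool × Name => y.2.1 == (u y.1).1 && decide (y.2.2 = (u y.1).2)) hT
    (and (bool_beq p2 (fst.comp (hu.comp fst))) (bits_eq p3 (snd.comp (hu.comp fst))))

theorem falsified (hT : Poly T) (hC : Poly C) : Poly fun a => falsified (T a) (C a) :=
  all (f := fun y => !KSat.holds (T y.1) y.2) hC (not (holds (hT.comp fst) snd))

theorem memVar (hZ : Poly Z) (hx : Poly x) : Poly fun a => memVar (Z a) (x a) :=
  any (f := fun y => decide (y.2 = x y.1)) hZ (bits_eq snd (hx.comp fst))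

theorem setLit (hT : Poly T) (hu : Poly u) : Poly fun a => setLit (T a) (u a) :=
  map (f := fun y : A × Bool × Name => if decide (y.2.2 = (u y.1).2) then u y.1 else y.2) hT
    (ite (bits_eq p3 (snd.comp (hu.comp fst))) (hu.comp fst) snd)

theorem tableSize (hT : Poly T) : PB fun a => tableSize (T a) :=
  ((PB.const 3).mul hT.size).mono fun _ => tableSize_le _

theorem setLits (hT : Poly T) (hu : Poly us) : Poly fun a => setLits (T a) (us a) :=
  foldl_of_measure (f := fun y => KSat.setLit y.2.1 y.2.2) hu hT (setLit p2 p3) (.const 0)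
    KSat.tableSize sz_le_tableSize (tableSize hT) fun _ _ _ _ => (tableSize_setLit _ _).le

theorem varsOf (hG : Poly G) : Poly fun a => varsOf (G a) :=
  map (f := fun y : A × Bool × Name => y.2.2) (flatten hG) p3

theorem packing (hF : Poly F) (hT : Poly T) : Poly fun a => packing (F a) (T a) :=
  foldl_of_add (f := fun y => if KSat.falsified (T y.1) y.2.2 && y.2.2.all fun u =>
    !KSat.memVar (KSat.varsOf y.2.1) u.2 then y.2.2 :: y.2.1 else y.2.1) hF nil
    (ite (and (falsified (hT.comp fst) p3) (all
      (f := fun z : (A × List (List (Bool × Name)) × List (Bool × Name)) × Bool × Name =>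
        !KSat.memVar (KSat.varsOf z.1.2.1) z.2.2) p3 (not (memVar (varsOf (p2.comp fst)) p3)))) (cons p3 p2) p2) hF.size fun a s e he => by
      have := sz_mem he
      dsimp only
      split
      · simp; omega
      · omega

theorem setNth (hT : Poly T) (hC : Poly C) (hj : Poly j) : Poly fun a => setNth (T a) (C a) (j a) :=
  caseList (c := fun y => KSat.setLit (T y.1) y.2.1) (drop hj hC) hT (setLit (hT.comp fst) p2)

theorem setWord (hT : Poly T) (hG : Poly G) (hw : Poly w) :
    Poly fun a => setWord (T a) (G a) (w a) :=
  foldl_of_measure (f := fun y : A × List (Bool × Name) × List (Bool × Name) × ℕ =>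
    KSat.setNth y.2.1 y.2.2.1 y.2.2.2) (zip hG hw) hT
    (setNth p2 (fst.comp p3) (snd.comp p3)) (.const 0)
    KSat.tableSize sz_le_tableSize (tableSize hT) fun _ _ _ _ => (tableSize_setNth _ _ _).le

variable {st : A → List (Bool × Name) × List Name} {st' : A → Bool × List (Bool × Name) × List Name}

theorem fixLit (hs : Poly st) (hC : Poly C) (hj : Poly j) :
    Poly fun a => fixLit (st a) (C a) (j a) := by
  have h1 : Poly fun a => (C a).filter fun u => !KSat.memVar (st a).2 u.2 :=
    filter (f := fun y : A × Bool × Name => !KSat.memVar (st y.1).2 y.2.2) hC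
      (not (memVar (snd.comp (hs.comp fst)) p3))
  have h2 : Poly fun y : A × (Bool × Name) × List (Bool × Name) =>
      (KSat.setLit (st y.1).1 y.2.1, y.2.1.2 :: (st y.1).2) :=
    (setLit (fst.comp (hs.comp fst)) p2).pair (cons (snd.comp p2) (snd.comp (hs.comp fst)))
  exact caseList (drop hj h1) hs h2

theorem fixStep (hF : Poly F) (hs : Poly st) (hj : Poly j) :
    Poly fun a => fixStep (F a) (st a) (j a) := by
  have h1 : Poly fun a => (F a).filter fun C => KSat.falsified (st a).1 C :=
    filter (f := fun y : A × List (Bool × Name) => KSat.falsified (st y.1).1 y.2) hF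
      (falsified (fst.comp (hs.comp fst)) snd)
  have h2 : Poly fun y : A × List (Bool × Name) × List (List (Bool × Name)) =>
      KSat.fixLit (st y.1) y.2.1 (j y.1) := fixLit (hs.comp fst) p2 (hj.comp fst)
  exact caseList h1 hs h2

/-- The measure of a state that bounds its growth. -/
def stateSize (st : List (Bool × Name) × List Name) : ℕ := KSat.tableSize st.1 + sz st.2 + 1

theorem sz_le_stateSize (st : List (Bool × Name) × List Name) : sz st ≤ stateSize st := by
  have := sz_le_tableSize st.1
  simp only [stateSize, sz_pair]; omega

theorem stateSize_poly (hs : Poly st) : PB fun a => stateSize (st a) :=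
  ((tableSize (fst.comp hs)).add (snd.comp hs).size).add (.const 1)

/-- Only the list of frozen variables grows, by one name that occurs in `F`. -/
theorem stateSize_fixStep (F : List (List (Bool × Name))) (st : List (Bool × Name) × List Name)
    (j : ℕ) : stateSize (KSat.fixStep F st j) ≤ stateSize st + sz F := by
  unfold KSat.fixStep
  cases h1 : F.filter fun C => KSat.falsified st.1 C with
  | nil => simp
  | cons C r =>
    have hC : C ∈ F := List.mem_of_mem_filter (h1 ▸ List.mem_cons_self)
    rw [caseList_cons]
    unfold KSat.fixLit
    cases h2 : (C.filter fun u => !KSat.memVar st.2 u.2).drop j with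
    | nil => simp
    | cons u r' =>
      have hu : u ∈ C := List.mem_of_mem_filter
        (List.mem_of_mem_drop (h2 ▸ List.mem_cons_self))
      have h3 := sz_mem hC
      have h4 := sz_mem hu
      have h5 := sz_pos u.1
      simp only [caseList_cons, stateSize, tableSize_setLit, sz_cons]
      simp only [sz_pair] at h4
      omega

theorem fixSteps (hF : Poly F) (hs : Poly st) (hw : Poly w) :
    Poly fun a => (w a).foldl (KSat.fixStep (F a)) (st a) :=
  foldl_of_measure (f := fun y => KSat.fixStep (F y.1) y.2.1 y.2.2) hw hs
    (fixStep (hF.comp fst) p2 p3) hF.size stateSize sz_le_stateSize (stateSize_poly hs)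
    fun _ _ _ _ => stateSize_fixStep _ _ _

theorem stateSize_fixSteps (F : List (List (Bool × Name))) (st : List (Bool × Name) × List Name)
    (w : List ℕ) : stateSize (w.foldl (KSat.fixStep F) st) ≤ stateSize st + w.length * sz F := by
  induction w generalizing st with
  | nil => simp
  | cons j w ih =>
    have := ih (KSat.fixStep F st j)
    have := stateSize_fixStep F st j
    simp only [List.foldl_cons, List.length_cons, add_mul]; omega

variable {β : A → List Bool}

theorem freeze (t : ℕ) (hF : Poly F) (hβ : Poly β) (hs : Poly st') :
    Poly fun a => freeze t (F a) (β a) (st' a) :=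
  have hG : Poly fun a => KSat.packing (F a) (st' a).2.1 := packing hF (p2.comp hs)
  ite (fst.comp hs) hs (ite (isEmpty (drop (const t) hG))
    ((const true).pair ((setLits (p2.comp hs) (zip hβ (varsOf hG))).pair (varsOf hG))) hs)

theorem stateSize_freeze (t : ℕ) (F : List (List (Bool × Name))) (β : List Bool)
    (st : Bool × List (Bool × Name) × List Name) :
    stateSize (KSat.freeze t F β st).2 ≤ stateSize st.2 + sz F := by
  have h1 := sz_packing F st.2.1
  have h2 := sz_varsOf (KSat.packing F st.2.1)
  unfold KSat.freeze
  split
  · omega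
  · split
    · simp only [stateSize, tableSize_setLits]; omega
    · omega

theorem round (t : ℕ) (hF : Poly F) (hβ : Poly β) (hs : Poly st') (hw : Poly w) :
    Poly fun a => round t (F a) (β a) (st' a) (w a) :=
  have h := freeze t hF hβ hs
  ite (fst.comp h) ((const true).pair (fixSteps hF (snd.comp h) hw))
    ((const false).pair ((setWord (p2.comp h) (packing hF (p2.comp h)) hw).pair (p3.comp h)))

theorem stateSize_round (t : ℕ) (F : List (List (Bool × Name))) (β : List Bool)
    (st : Bool × List (Bool × Name) × List Name) (w : List ℕ) :
    stateSize (KSat.round t F β st w).2 ≤ stateSize st.2 + (sz F + sz w * sz F) := by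
  have h1 := stateSize_freeze t F β st
  have h2 := stateSize_fixSteps F (KSat.freeze t F β st).2 w
  have h3 : w.length * sz F ≤ sz w * sz F := Nat.mul_le_mul_right _ (length_lt_sz w).le
  unfold KSat.round
  split
  · dsimp only; omega
  · simp only [stateSize, tableSize_setWord] at h1 ⊢; omega

variable {vs : A → List Name} {σ : A → List (List Bool × List (List ℕ))}

theorem walk (t : ℕ) (hF : Poly F) (hv : Poly vs) (hβ : Poly β) (hσ : Poly σ) :
    Poly fun a => walk t (F a) (vs a) (β a) (σ a) := by
  have hl : Poly fun a => ((σ a).map Prod.snd).flatten :=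
    flatten (map (f := fun z : A × List Bool × List (List ℕ) => z.2.2) hσ p3)
  have hi : Poly fun a => (false, KSat.setLits ((vs a).map fun x => (false, x))
      ((((σ a).map Prod.fst).flatten).zip (vs a)), ([] : List Name)) :=
    (const false).pair ((setLits (map (f := fun z : A × Name => (false, z.2)) hv
      ((const false).pair snd)) (zip (flatten
      (map (f := fun z : A × List Bool × List (List ℕ) => z.2.1) hσ p2)) hv)).pair nil)
  refine p2.comp (foldl_of_measure
    (f := fun z : A × (Bool × List (Bool × Name) × List Name) × List ℕ =>
      KSat.round t (F z.1) (β z.1) z.2.1 z.2.2) hl hi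
    (round t (hF.comp fst) (hβ.comp fst) p2 p3)
    (hF.size.add (hl.size.mul hF.size)) (fun s => stateSize s.2 + 4) (fun s => ?_) ?_ ?_)
  · have h1 := sz_le_stateSize s.2
    have h2 := sz_bool s.1
    rw [sz_pair]; omega
  · exact (stateSize_poly (snd.comp hi)).add (.const 4)
  · intro y s w hw
    have h1 := stateSize_round t (F y) (β y) s w
    have h2 := Nat.mul_le_mul_right (sz (F y)) (sz_mem hw).le
    dsimp only
    omega

theorem search (t : ℕ) (hF : Poly F) (hv : Poly vs) (hσ : Poly σ) :
    Poly fun a => search t (F a) (vs a) (σ a) := by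
  have h1 : Poly fun y : A × (List Bool × List (List ℕ)) × List (List Bool × List (List ℕ)) =>
      KSat.walk t (F y.1) (vs y.1) y.2.1.1 y.2.2 :=
    walk t (hF.comp fst) (hv.comp fst) (fst.comp p2) p3
  have h2 : Poly fun y : A × (List Bool × List (List ℕ)) × List (List Bool × List (List ℕ)) =>
      if (F y.1).all fun C => !KSat.falsified (KSat.walk t (F y.1) (vs y.1) y.2.1.1 y.2.2) C then
        Option.some (KSat.walk t (F y.1) (vs y.1) y.2.1.1 y.2.2) else none :=
    ite (all (f := fun z : (A × (List Bool × List (List ℕ)) × List (List Bool × List (List ℕ))) ×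
      List (Bool × Name) =>
        !KSat.falsified (KSat.walk t (F z.1.1) (vs z.1.1) z.1.2.1.1 z.1.2.2) z.2) (hF.comp fst)
      (not (falsified (h1.comp fst) snd))) (some h1) (const none)
  exact caseList hσ (const none) h2

theorem dedupVars (hF : Poly F) : Poly fun a => dedupVars (F a) :=
  foldl_of_add (f := fun y => if KSat.memVar y.2.1 y.2.2 then y.2.1 else y.2.2 :: y.2.1) (varsOf hF)
    nil (ite (memVar p2 p3) p2 (cons p3 p2)) (varsOf hF).size fun a s e he => by
      have := sz_mem he
      dsimp only
      split
      · omega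
      · simp; omega

end Poly

/-! ### Exhaustive search

A wheel is a nonempty list of options, together with the part of it that remains to be tried. The
current option is the first one of this part. -/

/-- A nonempty list of options. -/
abbrev Options (O : Type) := O × List O

/-- The remaining options, and all options. -/
abbrev Wheel (O : Type) := Options O × Options O

section Wheels

variable {O : Type}

/-- Advance the first wheel if there is a carry. -/
def advanceStep (st : Bool × List (Wheel O)) (w : Wheel O) : Bool × List (Wheel O) :=
  if st.1 then caseList w.1.2 (true, (w.2, w.2) :: st.2) fun e r => (false, ((e, r), w.2) :: st.2)
  else (false, w :: st.2)

/-- Advance a sequence of wheels. The first component tells that there is a carry at the end. -/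
def advance (ws : List (Wheel O)) : Bool × List (Wheel O) :=
  ((ws.foldl advanceStep (true, [])).1, (ws.foldl advanceStep (true, [])).2.reverse)

theorem foldl_advanceStep_false (ws acc : List (Wheel O)) :
    ws.foldl advanceStep (false, acc) = (false, ws.reverse ++ acc) := by
  induction ws generalizing acc with
  | nil => rfl
  | cons w ws ih => simp [advanceStep, ih]

theorem foldl_advanceStep (ws acc : List (Wheel O)) :
    ws.foldl advanceStep (true, acc) = ((advance ws).1, (advance ws).2.reverse ++ acc) := by
  induction ws generalizing acc with
  | nil => rfl
  | cons w ws ih =>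
    unfold advance
    obtain ⟨⟨o, l⟩, f⟩ := w
    cases l <;> simp [advanceStep, ih, foldl_advanceStep_false]

@[simp] theorem advance_nil : advance ([] : List (Wheel O)) = (true, []) := rfl

theorem advance_cons_nil (o : O) (f : Options O) (ws : List (Wheel O)) :
    advance (((o, []), f) :: ws) = ((advance ws).1, (f, f) :: (advance ws).2) := by
  conv_lhs => unfold advance
  simp [advanceStep, foldl_advanceStep]

theorem advance_cons_cons (o e : O) (r : List O) (f : Options O) (ws : List (Wheel O)) :
    advance (((o, e :: r), f) :: ws) = (false, ((e, r), f) :: ws) := by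
  conv_lhs => unfold advance
  simp [advanceStep, foldl_advanceStep_false]

/-- The number of times that the wheels can be advanced. -/
def rank : List (Wheel O) → ℕ
  | [] => 0
  | w :: ws => w.1.2.length + (w.2.2.length + 1) * rank ws

/-- The remaining options are a final segment of all options. -/
def Valid (ws : List (Wheel O)) : Prop := ∀ w ∈ ws, (w.1.1 :: w.1.2) <:+ (w.2.1 :: w.2.2)

/-- The numbers of options left after the current ones are the digits of `rank` in a mixed radix,
first wheel least significant. Advancing subtracts one with borrowing, and a carry out of the last
wheel means that all digits were zero. -/
theorem advance_spec (ws : List (Wheel O)) (h : Valid ws) :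
    Valid (advance ws).2 ∧ (advance ws).2.map Prod.snd = ws.map Prod.snd ∧
      ((advance ws).1 = true → rank ws = 0) ∧
      ((advance ws).1 = false → rank ws = rank (advance ws).2 + 1) := by
  induction ws with
  | nil => simp [Valid, rank]
  | cons w ws ih =>
    obtain ⟨h1, h2, h3, h4⟩ := ih fun w hw => h w (by simp [hw])
    obtain ⟨⟨o, l⟩, f⟩ := w
    cases l with
    | nil =>
      rw [advance_cons_nil]
      refine ⟨?_, by simp [h2], fun hc => ?_, fun hc => ?_⟩
      · intro w hw
        rcases List.mem_cons.1 hw with rfl | hw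
        · exact List.suffix_refl _
        · exact h1 w hw
      · simp [rank, h3 hc]
      · simp only [rank, h4 hc, List.length_nil]
        ring
    | cons e r =>
      rw [advance_cons_cons]
      refine ⟨?_, by simp, by simp, fun _ => ?_⟩
      · intro w hw
        rcases List.mem_cons.1 hw with rfl | hw
        · exact (List.suffix_cons o (e :: r)).trans (h ((o, e :: r), f) (by simp))
        · exact h w (by simp [hw])
      · simp only [rank, List.length_cons]; ring

theorem length_lt_of_valid {w : Wheel O} (h : (w.1.1 :: w.1.2) <:+ (w.2.1 :: w.2.2)) :
    w.1.2.length < w.2.2.length + 1 := by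
  have := h.length_le
  simp at this; omega

/-- Validity keeps every digit below its radix, so remainder and quotient recover the digits from
the rank, and a final segment is determined by its length. Counting the rank down to zero thus meets
every valid position. -/
theorem Valid.eq {ws ws' : List (Wheel O)} (h : Valid ws) (h' : Valid ws')
    (hs : ws.map Prod.snd = ws'.map Prod.snd) (hr : rank ws = rank ws') : ws = ws' := by
  induction ws generalizing ws' with
  | nil => cases ws' <;> simp_all
  | cons w ws ih =>
    cases ws' with
    | nil => simp at hs
    | cons w' ws' =>
      simp only [List.map_cons, List.cons.injEq] at hs
      obtain ⟨hs1, hs2⟩ := hs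
      have k := h w (by simp)
      have k' := h' w' (by simp)
      have l := length_lt_of_valid k
      have l' := length_lt_of_valid k'
      rw [← hs1] at k' l'
      simp only [rank, ← hs1] at hr
      have e1 : w.1.2.length = w'.1.2.length := by
        have := congrArg (· % (w.2.2.length + 1)) hr
        simpa [Nat.mod_eq_of_lt l, Nat.mod_eq_of_lt l'] using this
      rw [e1, Nat.add_left_cancel_iff] at hr
      have e2 := Nat.eq_of_mul_eq_mul_left (Nat.succ_pos _) hr
      rw [ih (fun w hw => h w (by simp [hw])) (fun w hw => h' w (by simp [hw])) hs2 e2]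
      have e3 : w.1.1 :: w.1.2 = w'.1.1 :: w'.1.2 :=
        (List.suffix_of_suffix_length_le k k' (by simp [e1])).eq_of_length (by simp [e1])
      rw [List.cons.injEq] at e3
      congr 1
      exact Prod.ext (Prod.ext e3.1 e3.2) hs1

/-- The wheels at their initial positions. -/
def startWheels (fs : List (Options O)) : List (Wheel O) := fs.map fun f => (f, f)

theorem valid_startWheels (fs : List (Options O)) : Valid (startWheels fs) := by
  intro w hw
  obtain ⟨f, -, rfl⟩ := List.mem_map.1 hw
  exact List.suffix_refl _

theorem map_snd_startWheels (fs : List (Options O)) : (startWheels fs).map Prod.snd = fs := by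
  simp [startWheels, Function.comp_def]

theorem rank_startWheels (fs : List (Options O)) :
    rank (startWheels fs) + 1 = (fs.map fun f => f.2.length + 1).prod := by
  induction fs with
  | nil => rfl
  | cons f fs ih =>
    rw [List.map_cons, List.prod_cons, ← ih]
    simp only [startWheels, List.map_cons, rank]; ring

theorem rank_le_startWheels {ws : List (Wheel O)} (h : Valid ws) :
    rank ws ≤ rank (startWheels (ws.map Prod.snd)) := by
  induction ws with
  | nil => simp [rank]
  | cons w ws ih =>
    have h1 := ih fun w hw => h w (by simp [hw])
    have h2 := length_lt_of_valid (h w (by simp))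
    simp only [startWheels, List.map_cons, rank] at h1 ⊢
    gcongr
    omega

theorem exists_wheels {σ : List O} {fs : List (Options O)}
    (h : List.Forall₂ (fun o f => o ∈ f.1 :: f.2) σ fs) :
    ∃ ws : List (Wheel O), Valid ws ∧ ws.map Prod.snd = fs ∧ ws.map (fun w => w.1.1) = σ := by
  induction h with
  | nil => exact ⟨[], by simp [Valid], rfl, rfl⟩
  | @cons o f σ fs h1 _ ih =>
    obtain ⟨ws, k1, k2, k3⟩ := ih
    obtain ⟨a, b, hab⟩ := List.append_of_mem h1
    refine ⟨((o, b), f) :: ws, ?_, by simp [k2], by simp [k3]⟩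
    intro w hw
    rcases List.mem_cons.1 hw with rfl | hw
    · exact ⟨a, hab.symm⟩
    · exact k1 w hw

variable [Enc O]

/-- This keeps the loop state polynomially small throughout an exponential number of iterations. -/
theorem sz_le_startWheels {ws : List (Wheel O)} (h : Valid ws) :
    sz ws ≤ sz (startWheels (ws.map Prod.snd)) := by
  induction ws with
  | nil => simp [startWheels]
  | cons w ws ih =>
    have h1 := ih fun w hw => h w (by simp [hw])
    have h2 := sz_suffix (h w (by simp))
    simp only [startWheels, List.map_cons, sz_cons, sz_pair] at h1 h2 ⊢
    omega

end Wheels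

namespace Poly

variable {A B O R E : Type} [Enc A] [Enc B] [Enc O] [Enc R] [Enc E]

theorem isSome {f : A → Option B} (hf : Poly f) : Poly fun a => (f a).isSome := by
  refine Poly.comp (g := fun o : Option B => o.isSome)
    ⟨.ite (.reg 0) (.assign 0 (.cons .nil .nil)) (.assign 0 .nil), fun _ => 6, .const _,
      (PB.const 3).mono fun o => sz_bool _, fun o => ?_⟩ hf
  refine (Runs.ite (T := 4) (fun s hs h => ?_) fun s hs h => ?_)
  · cases o with
    | none => exact absurd (by simp [Expr.eval, hs, enc]) h
    | some b => exact Runs.assign fun s _ => rfl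
  · cases o with
    | none => exact (Runs.assign fun s _ => rfl).mono (by simp [Expr.cost])
    | some b => simp [Expr.eval, hs, enc] at h

theorem advance {ws : A → List (Wheel O)} (hw : Poly ws) : Poly fun a => advance (ws a) := by
  have h1 : Poly fun x : A × (Bool × List (Wheel O)) × Wheel O => advanceStep x.2.1 x.2.2 := by
    have h2 : Poly fun y : (A × (Bool × List (Wheel O)) × Wheel O) × O × List O =>
        (false, ((y.2.1, y.2.2), y.1.2.2.2) :: y.1.2.1.2) :=
      (const false).pair (cons ((p2.pair p3).pair (snd.comp (p3.comp fst))) (snd.comp (p2.comp fst)))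
    exact ite (fst.comp p2) (caseList (snd.comp (fst.comp p3)) ((const true).pair
      (cons ((snd.comp p3).pair (snd.comp p3)) (snd.comp p2))) h2)
      ((const false).pair (cons p3 (snd.comp p2)))
  have h2 := foldl_of_measure (i := fun _ => (true, [])) hw ((const true).pair nil) h1
    ((PB.const 2).mul hw.size) (fun s => sz s.2 + 4)
    (fun s => by have := sz_bool s.1; simp; omega) (.const 5) fun a s w hm => by
      have h3 := sz_mem hm
      obtain ⟨c, acc⟩ := s
      obtain ⟨⟨o, l⟩, f⟩ := w
      simp only [sz_pair] at h3
      cases c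
      · simp [advanceStep]; omega
      · cases l <;> simp [advanceStep] at h3 ⊢ <;> omega
  exact (fst.comp h2).pair (reverse (snd.comp h2))

/-- The body of the loop of the exhaustive search. -/
def searchStep (V : E × List O → Option R) (x : (Wheel O × List (Wheel O)) × Option R × E) :
    List (Wheel O) × Option R × E :=
  -- An empty list of wheels ends the loop, both after a success and after the failure of the last
  -- position.
  if (V (x.2.2, (x.1.1 :: x.1.2).map fun w => w.1.1)).isSome then
    ([], V (x.2.2, (x.1.1 :: x.1.2).map fun w => w.1.1), x.2.2)
  else
    (if (KSat.advance (x.1.1 :: x.1.2)).1 then [] else (KSat.advance (x.1.1 :: x.1.2)).2,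
      none, x.2.2)

theorem searchStep_poly {V : E × List O → Option R} (hV : Poly V) : Poly (searchStep V) := by
  have h1 : Poly fun x : (Wheel O × List (Wheel O)) × Option R × E => x.1.1 :: x.1.2 :=
    cons (fst.comp fst) (snd.comp fst)
  have h2 : Poly fun x : (Wheel O × List (Wheel O)) × Option R × E =>
      V (x.2.2, (x.1.1 :: x.1.2).map fun w => w.1.1) :=
    hV.comp (p3.pair (map (f := fun y : ((Wheel O × List (Wheel O)) × Option R × E) × Wheel O =>
      y.2.1.1) h1 (fst.comp p2)))
  exact ite (isSome h2) (nil.pair (h2.pair p3))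
    ((ite (fst.comp (advance h1)) nil (snd.comp (advance h1))).pair ((const none).pair p3))

/-- Induction on the rank. A negative result speaks of all positions whose rank is at most the
current one: those of smaller rank are left to the rest of the loop, and the one of equal rank is
the current position by `Valid.eq`. -/
theorem loop_runs {V : E × List O → Option R} {q : Program} {T : ℕ} (e : E) (fs : List (Options O))
    (hfs : fs ≠ [])
    (hq : ∀ w ws, Valid (w :: ws) → (w :: ws).map Prod.snd = fs →
      Runs q (enc (w :: ws, (none : Option R), e)) (enc (searchStep V ((w, ws), none, e))) T)
    (ws : List (Wheel O)) (hv : Valid ws) (hw : ws.map Prod.snd = fs) :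
    ∃ res : Option R,
      Runs (.loop (.hd (.reg 0)) q) (enc (ws, (none : Option R), e))
        (enc (([] : List (Wheel O)), res, e)) ((rank ws + 1) * (T + 3) + 3) ∧
      (∀ y, res = Option.some y → ∃ σ, V (e, σ) = Option.some y) ∧
      (res = none → ∀ ws', Valid ws' → ws'.map Prod.snd = fs → rank ws' ≤ rank ws →
        V (e, ws'.map fun w => w.1.1) = none) := by
  induction hr : rank ws generalizing ws with
  | zero =>
    obtain ⟨w, ws, rfl⟩ := List.exists_cons_of_ne_nil (l := ws) (by rintro rfl; exact hfs hw.symm)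
    have hstep := hq w ws hv hw
    refine ⟨V (e, (w :: ws).map fun w => w.1.1), (Runs.loop_cons (by simp [enc, encodeList, Cell.hd])
      hstep (T' := 3) ?_).mono ?_, fun y hy => ⟨_, hy⟩, fun hn ws' h1 h2 h3 => ?_⟩
    · have hc : (KSat.advance (w :: ws)).1 = true := by
        by_contra hc
        have := (advance_spec _ hv).2.2.2 (by simpa using hc)
        omega
      rw [searchStep]
      cases h : V (e, (w :: ws).map fun w => w.1.1) <;> simp only [hc, if_true] <;>
        exact Runs.loop_nil rfl
    · omega
    · rw [h1.eq hv (h2.trans hw.symm) (by omega)]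
      exact hn
  | succ n ih =>
    obtain ⟨w, ws, rfl⟩ := List.exists_cons_of_ne_nil (l := ws) (by rintro rfl; exact hfs hw.symm)
    have hstep := hq w ws hv hw
    obtain ⟨s1, s2, s3, s4⟩ := advance_spec _ hv
    have hc : (KSat.advance (w :: ws)).1 = false := by
      by_contra hc
      have := s3 (by simpa using hc)
      omega
    obtain ⟨res, r1, r2, r3⟩ := ih _ s1 (s2.trans hw) (by have := s4 hc; omega)
    cases h : V (e, (w :: ws).map fun w => w.1.1) with
    | some y =>
      refine ⟨Option.some y, (Runs.loop_cons (by simp [enc, encodeList, Cell.hd])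
        hstep (T' := 3) ?_).mono ?_, fun y hy => ⟨_, h.trans hy⟩, by simp⟩
      · rw [searchStep]
        simp only [h]
        exact Runs.loop_nil rfl
      · ring_nf; omega
    | none =>
      refine ⟨res, (Runs.loop_cons (by simp [enc, encodeList, Cell.hd])
        hstep (T' := (n + 1) * (T + 3) + 3) ?_).mono ?_, r2, fun hn ws' h1 h2 h3 => ?_⟩
      · rw [searchStep]
        simp only [h, hc]
        exact r1
      · ring_nf; omega
      · rcases h3.lt_or_eq with h3 | h3
        · exact r3 hn ws' h1 h2 (by omega)
        · rw [h1.eq hv (h2.trans hw.symm) (by omega)]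
          exact h

/-- Exhaustive search over the product of a sequence of sets of options. -/
theorem exhaustive_search {V : E × List O → Option R} {fs : E → List (Options O)} (hV : Poly V)
    (hf : Poly fs) (hne : ∀ e, fs e ≠ []) :
    ∃ (p : Program) (T : E → ℕ), PB T ∧ ∀ e, ∃ res : Option R,
      Runs p (enc e) (enc res) (T e * ((fs e).map fun f => f.2.length + 1).prod) ∧
      (∀ y, res = Option.some y → ∃ σ, V (e, σ) = Option.some y) ∧
      (res = none → ∀ σ, List.Forall₂ (fun o f => o ∈ f.1 :: f.2) σ (fs e) → V (e, σ) = none) := by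
  have hs : Poly fun e => startWheels (fs e) :=
    map (f := fun y : E × Options O => (y.2, y.2)) hf (snd.pair snd)
  obtain ⟨p, T, h1, -, h3⟩ := (hs.pair ((const (none : Option R)).pair id) :
    Poly fun e : E => (startWheels (fs e), (none : Option R), e))
  obtain ⟨q, U, ⟨c, hc⟩, -, k3⟩ := searchStep_poly hV
  let W : E → ℕ := fun e => (sz (startWheels (fs e)) + sz e + 4) ^ c
  have hW : PB W := ((hs.size.add .size).add (.const 4)).pow c
  refine ⟨.seq p (.seq (.loop (.hd (.reg 0)) q) (.assign 0 (.hd (.tl (.reg 0))))),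
    fun e => T e + (W e + 3) + 3 + 4, ((h1.add (hW.add (.const 3))).add (.const 3)).add (.const 4),
    fun e => ?_⟩
  have hq : ∀ w ws, Valid (w :: ws) → (w :: ws).map Prod.snd = fs e →
      Runs q (enc (w :: ws, (none : Option R), e)) (enc (searchStep V ((w, ws), none, e))) (W e) := by
    refine fun w ws hv hw => (k3 ((w, ws), none, e)).mono ((hc _).trans (Nat.pow_le_pow_left ?_ c))
    have := sz_le_startWheels hv
    rw [hw] at this
    simp only [sz_cons, sz_pair, sz_none] at this ⊢
    omega
  obtain ⟨res, r1, r2, r3⟩ := loop_runs e (fs e) (hne e) hq (startWheels (fs e))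
    (valid_startWheels _) (map_snd_startWheels _)
  refine ⟨res, ((h3 e).seq (r1.seq (Runs.assign (y := enc res) fun s hs => by
    simp [Expr.eval, hs, enc, Cell.hd, Cell.tl]))).mono ?_, r2, fun hn σ hσ => ?_⟩
  · rw [rank_startWheels]
    have : 0 < ((fs e).map fun f => f.2.length + 1).prod := by
      rw [← rank_startWheels]; omega
    simp only [Expr.cost]
    nlinarith
  · obtain ⟨ws, w1, w2, w3⟩ := exists_wheels hσ
    rw [← w3]
    exact r3 hn ws w1 w2 (by have := rank_le_startWheels w1; rwa [w2] at this)

end Poly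

/-! ### Correctness of the local search -/

/-- The number of positions at which two words differ. -/
def mism {B : Type} [DecidableEq B] : List B → List B → ℕ
  | a :: l, b :: m => (if a = b then 0 else 1) + mism l m
  | _, _ => 0

section Mism

variable {B : Type} [DecidableEq B]

@[simp] theorem mism_nil_left (m : List B) : mism [] m = 0 := by cases m <;> rfl
@[simp] theorem mism_nil_right (m : List B) : mism m [] = 0 := by cases m <;> rfl
@[simp] theorem mism_cons (a b : B) (l m : List B) :
    mism (a :: l) (b :: m) = (if a = b then 0 else 1) + mism l m := rfl

theorem mism_append {c y : List B} (h : c.length = y.length) (r z : List B) :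
    mism (c ++ r) (y ++ z) = mism c y + mism r z := by
  induction c generalizing y with
  | nil =>
    cases y with
    | nil => simp
    | cons => simp at h
  | cons a c ih =>
    cases y with
    | nil => simp at h
    | cons b y => simp [ih (by simpa using h), add_assoc]

theorem mism_le_append (c y z : List B) : mism c y ≤ mism c (y ++ z) := by
  induction c generalizing y with
  | nil => simp
  | cons a c ih => cases y <;> simp [ih]

theorem mism_take (c y : List B) : mism (c.take y.length) y = mism c y := by
  induction c generalizing y with
  | nil => simp
  | cons a c ih => cases y <;> simp [ih]

/-- A code for blocks of length `b` covers words of length `b * N` block by block. -/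
theorem exists_blocks {O : List (List B)} {b d : ℕ}
    (hO : ∀ y : List B, y.length = b → ∃ c ∈ O, c.length = b ∧ mism c y ≤ d) (N : ℕ) (y : List B)
    (hy : y.length = b * N) :
    ∃ cs : List (List B), cs.length = N ∧ (∀ c ∈ cs, c ∈ O) ∧ cs.flatten.length = b * N ∧
      mism cs.flatten y ≤ d * N := by
  induction N generalizing y with
  | zero => exact ⟨[], by simp⟩
  | succ N ih =>
    have h1 : (y.take b).length = b := by rw [List.length_take, hy, mul_add]; simp
    obtain ⟨c, c1, c2, c3⟩ := hO _ h1
    obtain ⟨cs, e1, e2, e3, e4⟩ := ih (y.drop b) (by rw [List.length_drop, hy, mul_add]; simp)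
    refine ⟨c :: cs, by simp [e1], by simpa [c1] using e2, ?_, ?_⟩
    · simp only [List.flatten_cons, List.length_append, c2, e3]; ring
    · rw [List.flatten_cons, ← List.take_append_drop b y, mism_append (c2.trans h1.symm)]
      calc _ ≤ d + d * N := add_le_add c3 e4
        _ = _ := by ring

end Mism

theorem exists_flatten_eq {B : Type} (q N : ℕ) (l : List B) (hl : l.length = q * N) :
    ∃ gs : List (List B), gs.length = N ∧ (∀ g ∈ gs, g.length = q) ∧ gs.flatten = l := by
  induction N generalizing l with
  | zero => exact ⟨[], by simp_all⟩
  | succ N ih =>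
    obtain ⟨gs, e1, e2, e3⟩ := ih (l.drop q) (by rw [List.length_drop, hl, mul_add]; simp)
    refine ⟨l.take q :: gs, by simp [e1], ?_, by simp [e3]⟩
    intro g hg
    rcases List.mem_cons.1 hg with rfl | hg
    · rw [List.length_take, hl, mul_add]; simp
    · exact e2 g hg

theorem mem_varsOf {X : Type} {G : List (List (Bool × X))} {x : X} :
    x ∈ varsOf G ↔ ∃ C ∈ G, ∃ u ∈ C, u.2 = x := by
  simp only [varsOf, List.mem_map, List.mem_flatten]
  constructor
  · rintro ⟨u, ⟨C, hC, hu⟩, rfl⟩; exact ⟨C, hC, u, hu, rfl⟩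
  · rintro ⟨C, hC, u, hu, rfl⟩; exact ⟨u, ⟨C, hC, hu⟩, rfl⟩

section Correctness

variable {X : Type} [DecidableEq X]

/-- The table of an assignment. -/
def tab (α : X → Bool) (vs : List X) : List (Bool × X) := vs.map fun x => (α x, x)

/-- The assignment after making some literals true, one after the other. -/
def updates (α : X → Bool) (us : List (Bool × X)) : X → Bool :=
  us.foldl (fun α u => Function.update α u.2 u.1) α

/-- The assignment `α` satisfies `F`. -/
def Sat (F : List (List (Bool × X))) (α : X → Bool) : Prop := ∀ C ∈ F, ∃ u ∈ C, α u.2 = u.1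

/-- The number of variables at which two assignments differ. -/
def dist (vs : List X) (α α' : X → Bool) : ℕ := (vs.toFinset.filter fun x => α x ≠ α' x).card

/-! ### Tables as assignments -/

theorem setLit_tab (α : X → Bool) (vs : List X) (u : Bool × X) :
    setLit (tab α vs) u = tab (Function.update α u.2 u.1) vs := by
  unfold setLit tab
  rw [List.map_map]
  refine List.map_congr_left fun x _ => ?_
  by_cases h : x = u.2
  · subst h; simp
  · simp [h]

theorem setLits_tab (α : X → Bool) (vs : List X) (us : List (Bool × X)) :
    setLits (tab α vs) us = tab (updates α us) vs := by
  unfold setLits updates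
  induction us generalizing α with
  | nil => rfl
  | cons u us ih => rw [List.foldl_cons, setLit_tab, ih, List.foldl_cons]

theorem exists_setNth_tab (α : X → Bool) (vs : List X) (C : List (Bool × X)) (j : ℕ) :
    ∃ α', setNth (tab α vs) C j = tab α' vs := by
  unfold setNth
  cases C.drop j
  · exact ⟨_, rfl⟩
  · exact ⟨_, setLit_tab _ _ _⟩

theorem exists_setWord_tab (α : X → Bool) (vs : List X) (G : List (List (Bool × X))) (w : List ℕ) :
    ∃ α', setWord (tab α vs) G w = tab α' vs := by
  unfold setWord
  induction G.zip w generalizing α with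
  | nil => exact ⟨_, rfl⟩
  | cons p r ih =>
    obtain ⟨α', h⟩ := exists_setNth_tab α vs p.1 p.2
    rw [List.foldl_cons, h]
    exact ih α'

theorem exists_fixStep_tab (F : List (List (Bool × X))) (α : X → Bool) (vs Z : List X) (j : ℕ) :
    ∃ α' Z', fixStep F (tab α vs, Z) j = (tab α' vs, Z') := by
  unfold fixStep
  cases F.filter fun C => falsified (tab α vs) C with
  | nil => exact ⟨_, _, rfl⟩
  | cons C r =>
    simp only [caseList_cons, fixLit]
    cases (C.filter fun u => !memVar Z u.2).drop j with
    | nil => exact ⟨_, _, rfl⟩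
    | cons u r => exact ⟨_, _, by rw [caseList_cons, setLit_tab]⟩

theorem exists_fixSteps_tab (F : List (List (Bool × X))) (α : X → Bool) (vs Z : List X)
    (w : List ℕ) : ∃ α' Z', w.foldl (fixStep F) (tab α vs, Z) = (tab α' vs, Z') := by
  induction w generalizing α Z with
  | nil => exact ⟨_, _, rfl⟩
  | cons j w ih =>
    obtain ⟨α', Z', h⟩ := exists_fixStep_tab F α vs Z j
    rw [List.foldl_cons, h]
    exact ih α' Z'

theorem exists_round_tab (t : ℕ) (F : List (List (Bool × X))) (β : List Bool) (b : Bool)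
    (α : X → Bool) (vs Z : List X) (w : List ℕ) :
    ∃ b' α' Z', round t F β (b, tab α vs, Z) w = (b', tab α' vs, Z') := by
  obtain ⟨b₁, α₁, Z₁, h⟩ : ∃ b' α' Z', freeze t F β (b, tab α vs, Z) = (b', tab α' vs, Z') := by
    unfold freeze
    split
    · exact ⟨_, _, _, rfl⟩
    · split
      · exact ⟨_, _, _, by rw [setLits_tab]⟩
      · exact ⟨_, _, _, rfl⟩
  unfold round
  simp only [h]
  split
  · obtain ⟨α', Z', h'⟩ := exists_fixSteps_tab F α₁ vs Z₁ w
    exact ⟨_, _, _, by rw [h']⟩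
  · obtain ⟨α', h'⟩ := exists_setWord_tab α₁ vs (packing F (tab α₁ vs)) w
    exact ⟨_, _, _, by rw [h']⟩

/-- Soundness needs nothing about the choices: all operations only overwrite signs, so the final
table always belongs to some assignment, and `search` tests it before returning it. -/
theorem exists_walk_tab (t : ℕ) (F : List (List (Bool × X))) (vs : List X) (β : List Bool)
    (r : List (List Bool × List (List ℕ))) : ∃ α, walk t F vs β r = tab α vs := by
  have h : ∀ (ws : List (List ℕ)) (b : Bool) (α : X → Bool) (Z : List X),
      ∃ b' α' Z', ws.foldl (round t F β) (b, tab α vs, Z) = (b', tab α' vs, Z') := by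
    intro ws
    induction ws with
    | nil => exact fun b α Z => ⟨_, _, _, rfl⟩
    | cons w ws ih =>
      intro b α Z
      obtain ⟨b', α', Z', h⟩ := exists_round_tab t F β b α vs Z w
      rw [List.foldl_cons, h]
      exact ih b' α' Z'
  have h0 : (vs.map fun x => (false, x)) = tab (fun _ => false) vs := rfl
  unfold walk
  rw [h0, setLits_tab]
  obtain ⟨b', α', Z', h1⟩ := h (r.map Prod.snd).flatten false
    (updates (fun _ => false) (((r.map Prod.fst).flatten).zip vs)) []
  exact ⟨α', by rw [h1]⟩

variable {F : List (List (Bool × X))} {vs : List X}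

theorem holds_tab {α : X → Bool} {u : Bool × X} (hu : u.2 ∈ vs) :
    holds (tab α vs) u = true ↔ α u.2 = u.1 := by
  simp only [holds, tab, List.any_map, List.any_eq_true, Function.comp, Bool.and_eq_true,
    beq_iff_eq, decide_eq_true_eq]
  constructor
  · rintro ⟨x, -, h1, rfl⟩; exact h1
  · intro h; exact ⟨_, hu, h, rfl⟩

theorem falsified_tab {α : X → Bool} {C : List (Bool × X)} (hC : ∀ u ∈ C, u.2 ∈ vs) :
    falsified (tab α vs) C = true ↔ ∀ u ∈ C, α u.2 ≠ u.1 := by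
  simp only [falsified, List.all_eq_true, Bool.not_eq_true', ← Bool.not_eq_true]
  exact forall₂_congr fun u hu => not_congr (holds_tab (hC u hu))

theorem sat_of_search (hF : ∀ C ∈ F, ∀ u ∈ C, u.2 ∈ vs) {t : ℕ}
    {σ : List (List Bool × List (List ℕ))} {T : List (Bool × X)} (h : search t F vs σ = some T) :
    ∃ α, T = tab α vs ∧ Sat F α := by
  unfold search at h
  cases σ with
  | nil => simp at h
  | cons B r =>
    rw [caseList_cons] at h
    split at h
    · rename_i hc
      obtain ⟨α, hα⟩ := exists_walk_tab t F vs B.1 r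
      rw [hα] at hc h
      refine ⟨α, (Option.some.inj h).symm, fun C hC => ?_⟩
      have := List.all_eq_true.1 hc C hC
      by_contra hn
      push Not at hn
      rw [(falsified_tab (hF C hC)).2 hn] at this
      simp at this
    · simp at h

theorem memVar_iff {Z : List X} {x : X} : memVar Z x = true ↔ x ∈ Z := by
  simp [memVar]

theorem memVar_eq_false_iff {Z : List X} {x : X} : memVar Z x = false ↔ x ∉ Z := by
  rw [← memVar_iff, Bool.not_eq_true]

/-- The clauses `C` and `C'` have no common variable. -/
def VarDisjoint (C C' : List (Bool × X)) : Prop := ∀ u ∈ C, ∀ v ∈ C', u.2 ≠ v.2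

/-- The last part is the maximality of the greedy choice. It needs `C ≠ []`, because an empty clause
has no variable to share. The induction has to run over an arbitrary accumulator. -/
theorem packing_spec (F : List (List (Bool × X))) (T : List (Bool × X)) :
    (∀ C ∈ packing F T, C ∈ F ∧ falsified T C = true) ∧ (packing F T).Pairwise VarDisjoint ∧
    (∀ C ∈ F, falsified T C = true → C ≠ [] → ∃ u ∈ C, u.2 ∈ varsOf (packing F T)) := by
  have h : ∀ (L : List (List (Bool × X))) (G : List (List (Bool × X))),
      let G' := L.foldl (fun G C => if falsified T C && C.all fun u => !memVar (varsOf G) u.2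
        then C :: G else G) G
      G.Pairwise VarDisjoint → (∀ C ∈ G, C ∈ G') ∧
      (∀ C ∈ G', C ∈ G ∨ C ∈ L ∧ falsified T C = true) ∧ G'.Pairwise VarDisjoint ∧
      (∀ C ∈ L, falsified T C = true → C ≠ [] → ∃ u ∈ C, u.2 ∈ varsOf G') := by
    intro L
    induction L with
    | nil => intro G G' hG; exact ⟨fun C h => h, fun C h => .inl h, hG, by simp⟩
    | cons D L ih =>
      intro G
      simp only [List.foldl_cons]
      intro hG
      split
      · rename_i hD
        simp only [Bool.and_eq_true, List.all_eq_true, Bool.not_eq_true', memVar_eq_false_iff] at hD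
        obtain ⟨h1, h2, h3, h4⟩ := ih (D :: G) (List.pairwise_cons.2 ⟨fun C hC u hu v hv huv =>
          hD.2 u hu (mem_varsOf.2 ⟨C, hC, v, hv, huv.symm⟩), hG⟩)
        refine ⟨fun C hC => h1 C (by simp [hC]), fun C hC => ?_, h3, fun C hC hf hn => ?_⟩
        · rcases h2 C hC with h | h
          · rcases List.mem_cons.1 h with rfl | h
            · exact .inr ⟨by simp, hD.1⟩
            · exact .inl h
          · exact .inr ⟨by simp [h.1], h.2⟩
        · rcases List.mem_cons.1 hC with rfl | hC
          · obtain ⟨u, r, rfl⟩ := List.exists_cons_of_ne_nil hn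
            exact ⟨u, by simp, mem_varsOf.2 ⟨u :: r, h1 (u :: r) (by simp), u, by simp, rfl⟩⟩
          · exact h4 C hC hf hn
      · rename_i hD
        obtain ⟨h1, h2, h3, h4⟩ := ih G hG
        refine ⟨h1, fun C hC => ?_, h3, fun C hC hf hn => ?_⟩
        · rcases h2 C hC with h | h
          · exact .inl h
          · exact .inr ⟨by simp [h.1], h.2⟩
        · rcases List.mem_cons.1 hC with rfl | hC
          · simp only [Bool.and_eq_true, hf, List.all_eq_true, Bool.not_eq_true',
              memVar_eq_false_iff, true_and, not_forall, not_not] at hD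
            obtain ⟨u, hu, hu'⟩ := hD
            obtain ⟨D, hD, v, hv, huv⟩ := mem_varsOf.1 hu'
            exact ⟨u, hu, mem_varsOf.2 ⟨D, h1 D hD, v, hv, huv⟩⟩
          · exact h4 C hC hf hn
  obtain ⟨-, h2, h3, h4⟩ := h F [] List.Pairwise.nil
  exact ⟨fun C hC => (h2 C hC).resolve_left (by simp), h3, h4⟩

/-! ### Distance to a satisfying assignment -/

section Dist

variable {α αs : X → Bool} {u : Bool × X}

theorem dist_update_lt (hu : u.2 ∈ vs) (h1 : α u.2 ≠ u.1) (h2 : αs u.2 = u.1) :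
    dist vs (Function.update α u.2 u.1) αs + 1 ≤ dist vs α αs := by
  unfold dist
  refine Finset.card_lt_card (Finset.ssubset_iff_subset_ne.2 ⟨fun x hx => ?_, fun h => ?_⟩)
  · simp only [Finset.mem_filter, Function.update_apply] at hx ⊢
    refine ⟨hx.1, ?_⟩
    by_cases hxu : x = u.2
    · subst hxu; simp [h2] at hx
    · simpa [hxu] using hx.2
  · have : u.2 ∈ vs.toFinset.filter fun x => α x ≠ αs x := by simp [hu, h1, h2]
    rw [← h] at this
    simp [h2] at this

theorem dist_update_le : dist vs (Function.update α u.2 u.1) αs ≤ dist vs α αs + 1 := by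
  unfold dist
  refine le_trans (Finset.card_le_card (t := insert u.2 (vs.toFinset.filter fun x => α x ≠ αs x))
    fun x hx => ?_) (Finset.card_insert_le _ _)
  simp only [Finset.mem_filter, Function.update_apply, Finset.mem_insert] at hx ⊢
  by_cases hxu : x = u.2
  · exact .inl hxu
  · exact .inr (by simpa [hxu] using hx)

/-- Freezing variables at their values under `αs` does no harm. -/
theorem dist_le_of_imp {α' : X → Bool} (h : ∀ x, α' x ≠ α x → α' x = αs x) :
    dist vs α' αs ≤ dist vs α αs := by
  refine Finset.card_le_card fun x hx => ?_
  simp only [Finset.mem_filter] at hx ⊢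
  refine ⟨hx.1, fun hx' => hx.2 ?_⟩
  by_cases hxx : α' x = α x
  · rw [hxx, hx']
  · exact h x hxx

theorem sat_of_dist_eq_zero (hF : ∀ C ∈ F, ∀ u ∈ C, u.2 ∈ vs) (hs : Sat F αs)
    (h : dist vs α αs = 0) : Sat F α := by
  intro C hC
  obtain ⟨u, hu, hu'⟩ := hs C hC
  refine ⟨u, hu, ?_⟩
  by_contra hn
  have : u.2 ∈ vs.toFinset.filter fun x => α x ≠ αs x := by
    simp [hF C hC u hu, hu', hn]
  rw [Finset.card_eq_zero.1 h] at this
  simp at this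

/-- Order and repetitions of the literals are irrelevant, since all of them agree with `αs`. -/
theorem updates_apply_of_agree (us : List (Bool × X)) (h : ∀ u ∈ us, αs u.2 = u.1) (x : X) :
    updates α us x = if x ∈ us.map Prod.snd then αs x else α x := by
  unfold updates
  induction us generalizing α with
  | nil => simp
  | cons u us ih =>
    rw [List.foldl_cons, ih fun u hu => h u (by simp [hu])]
    by_cases h1 : x ∈ us.map Prod.snd
    · simp only [h1, if_true, List.map_cons, List.mem_cons, or_true]
    · by_cases h2 : x = u.2
      · subst h2
        simp only [h1, if_false, List.map_cons, List.mem_cons, true_or, if_true,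
          Function.update_self]
        exact (h u (by simp)).symm
      · simp only [h1, if_false, List.map_cons, List.mem_cons, h2, false_or,
          Function.update_of_ne h2]

theorem updates_apply_of_notMem (us : List (Bool × X)) (x : X) (h : x ∉ us.map Prod.snd) :
    updates α us x = α x := by
  unfold updates
  induction us generalizing α with
  | nil => rfl
  | cons u us ih =>
    simp only [List.map_cons, List.mem_cons, not_or] at h
    rw [List.foldl_cons, ih h.2, Function.update_of_ne h.1]

theorem map_updates_zip (hv : vs.Nodup) (bs : List Bool) (hb : vs.length ≤ bs.length) :
    vs.map (updates α (bs.zip vs)) = bs.take vs.length := by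
  induction vs generalizing α bs with
  | nil => simp
  | cons x vs ih =>
    cases bs with
    | nil => simp at hb
    | cons b bs =>
      rw [List.nodup_cons] at hv
      have h1 : updates α ((b :: bs).zip (x :: vs)) = updates (Function.update α x b) (bs.zip vs) :=
        rfl
      rw [h1, List.map_cons, ih hv.2 bs (by simpa using hb), updates_apply_of_notMem]
      · simp
      · intro h
        obtain ⟨u, hu, hx⟩ := List.mem_map.1 h
        exact hv.1 (hx ▸ (List.of_mem_zip hu).2)

theorem dist_eq_mism (hv : vs.Nodup) : dist vs α αs = mism (vs.map α) (vs.map αs) := by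
  unfold dist
  induction vs with
  | nil => rfl
  | cons x vs ih =>
    rw [List.nodup_cons] at hv
    rw [List.toFinset_cons, Finset.filter_insert, List.map_cons, List.map_cons, mism_cons, ← ih hv.2]
    by_cases h : α x = αs x
    · simp [h]
    · rw [if_pos h, if_neg h, Finset.card_insert_of_notMem (by simp [hv.1]), add_comm]

end Dist

/-! ### Progress in the two modes of a round -/

section Rounds

variable {αs : X → Bool} {k t s d : ℕ}

/-- The invariant of the second mode: the frozen variables have their final values, and meet every
falsified clause. -/
def Frozen (F : List (List (Bool × X))) (αs α : X → Bool) (Z : List X) : Prop :=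
  (∀ x ∈ Z, α x = αs x) ∧ ∀ C ∈ F, (∀ u ∈ C, α u.2 ≠ u.1) → ∃ u ∈ C, u.2 ∈ Z

variable (hF : ∀ C ∈ F, ∀ u ∈ C, u.2 ∈ vs) (hk : ∀ C ∈ F, C.length ≤ k) (hs : Sat F αs)

include hF hk hs

/-- A literal of the falsified clause that is true under `αs` cannot have a frozen variable, as
frozen variables already agree with `αs`. The clause also contains a literal whose variable is
frozen, so fewer than `k` candidates remain. The invariant survives: a clause containing the new
frozen variable meets the frozen set, and any other falsified clause was falsified before. The
alternative `Sat F α` allows for idle steps after success. -/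
theorem exists_fixStep (h2 : 2 ≤ k) {α : X → Bool} {Z : List X} (hZ : Frozen F αs α Z) {n : ℕ}
    (hn : Sat F α ∨ dist vs α αs ≤ n + 1) :
    ∃ j < k - 1, ∃ α' Z', fixStep F (tab α vs, Z) j = (tab α' vs, Z') ∧ Frozen F αs α' Z' ∧
      (Sat F α' ∨ dist vs α' αs ≤ n) := by
  unfold fixStep
  cases h : F.filter fun C => falsified (tab α vs) C with
  | nil =>
    -- Nothing is falsified, so the step is idle and any letter will do; `0` is one because `2 ≤ k`.
    refine ⟨0, by omega, α, Z, rfl, hZ, .inl fun C hC => ?_⟩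
    by_contra hc
    push Not at hc
    have : C ∈ F.filter fun C => falsified (tab α vs) C :=
      List.mem_filter.2 ⟨hC, (falsified_tab (hF C hC)).2 hc⟩
    rw [h] at this
    simp at this
  | cons C r =>
    have hC : C ∈ F.filter fun C => falsified (tab α vs) C := h ▸ List.mem_cons_self
    obtain ⟨hC, hf⟩ := List.mem_filter.1 hC
    rw [falsified_tab (hF C hC)] at hf
    obtain ⟨u, hu, hu'⟩ := hs C hC
    have huZ : u.2 ∉ Z := fun hz => hf u hu ((hZ.1 _ hz).trans hu')
    have hu2 : u ∈ C.filter fun u => !memVar Z u.2 :=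
      List.mem_filter.2 ⟨hu, by simpa [memVar_eq_false_iff] using huZ⟩
    obtain ⟨j, hj, hju⟩ := List.mem_iff_getElem.1 hu2
    have hlt : (C.filter fun u => !memVar Z u.2).length < C.length := by
      obtain ⟨v, hv, hvZ⟩ := hZ.2 C hC hf
      rw [List.length_filter_lt_length_iff_exists]
      exact ⟨v, hv, by simpa [memVar_iff] using hvZ⟩
    refine ⟨j, by have := hk C hC; omega, Function.update α u.2 u.1, u.2 :: Z, ?_, ⟨?_, ?_⟩, ?_⟩
    · rw [caseList_cons, fixLit, List.drop_eq_getElem_cons hj, caseList_cons, hju, setLit_tab]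
    · intro x hx
      by_cases hxu : x = u.2
      · subst hxu; simp [hu']
      · rw [Function.update_of_ne hxu]
        exact hZ.1 x ((List.mem_cons.1 hx).resolve_left hxu)
    · intro D hD hDf
      by_cases hDu : ∃ v ∈ D, v.2 = u.2
      · obtain ⟨v, hv, hvu⟩ := hDu
        exact ⟨v, hv, by simp [hvu]⟩
      · push Not at hDu
        obtain ⟨v, hv, hvZ⟩ := hZ.2 D hD fun v hv => by
          have := hDf v hv
          rwa [Function.update_of_ne (hDu v hv)] at this
        exact ⟨v, hv, by simp [hvZ]⟩
    · right
      have h1 := dist_update_lt (hF C hC u hu) (hf u hu) hu'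
      rcases hn with hn | hn
      · obtain ⟨v, hv, hv'⟩ := hn C hC
        exact absurd hv' (hf v hv)
      · omega

theorem exists_fixSteps (h2 : 2 ≤ k) (d : ℕ) {α : X → Bool} {Z : List X} (hZ : Frozen F αs α Z)
    {n : ℕ} (hn : Sat F α ∨ dist vs α αs ≤ n + d) :
    ∃ w : List ℕ, w.length = d ∧ (∀ j ∈ w, j < k - 1) ∧ ∃ α' Z',
      w.foldl (fixStep F) (tab α vs, Z) = (tab α' vs, Z') ∧ Frozen F αs α' Z' ∧
      (Sat F α' ∨ dist vs α' αs ≤ n) := by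
  induction d generalizing α Z with
  | zero => exact ⟨[], rfl, by simp, α, Z, rfl, hZ, hn⟩
  | succ d ih =>
    obtain ⟨j, hj, α₁, Z₁, e1, e2, e3⟩ := exists_fixStep hF hk hs h2 hZ (n := n + d) hn
    obtain ⟨w, w1, w2, α', Z', e4, e5⟩ := ih e2 e3
    exact ⟨j :: w, by simp [w1], by simpa [hj] using w2, α', Z', by rw [List.foldl_cons, e1, e4], e5⟩

variable {S : List (List ℕ)}
  (hS : ∀ w : List ℕ, w.length = d → (∀ j ∈ w, j < k - 1) → w ∈ S)

include hS

theorem exists_frozen_rounds (h2 : 2 ≤ k) (β : List Bool) (m : ℕ) {α : X → Bool} {Z : List X}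
    (hZ : Frozen F αs α Z) (hn : Sat F α ∨ dist vs α αs ≤ d * m) :
    ∃ ws : List (List ℕ), ws.length = m ∧ (∀ w ∈ ws, w ∈ S) ∧ ∃ α', Sat F α' ∧
      (ws.foldl (round t F β) (true, tab α vs, Z)).2.1 = tab α' vs := by
  induction m generalizing α Z with
  | zero =>
    exact ⟨[], rfl, by simp, α, hn.elim id fun h => sat_of_dist_eq_zero hF hs (by omega), rfl⟩
  | succ m ih =>
    obtain ⟨w, w1, w2, α₁, Z₁, e1, e2, e3⟩ := exists_fixSteps hF hk hs h2 d hZ (n := d * m) hn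
    obtain ⟨ws, v1, v2, α', e4, e5⟩ := ih e2 e3
    refine ⟨w :: ws, by simp [v1], by simpa [hS w w1 w2] using v2, α', e4, ?_⟩
    rw [List.foldl_cons, ← e5]
    simp [round, freeze, e1]

omit hF hk hs hS

/-- A right letter gains one and a wrong letter loses at most one, which adds up to `2 * mism w ws -
w.length`. As the clauses share no variables, treating one of them leaves the others falsified, so
each right letter really flips a wrong variable. -/
theorem setWord_dist {α : X → Bool} (G : List (List (Bool × X))) (w ws : List ℕ)
    (hG : ∀ C ∈ G, ∀ u ∈ C, u.2 ∈ vs) (hf : ∀ C ∈ G, ∀ u ∈ C, α u.2 ≠ u.1)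
    (hd : G.Pairwise VarDisjoint)
    (hws : List.Forall₂ (fun C j => ∃ u, C[j]? = some u ∧ αs u.2 = u.1) G ws)
    (hw : w.length = ws.length) :
    ∃ α', setWord (tab α vs) G w = tab α' vs ∧
      dist vs α' αs + w.length ≤ dist vs α αs + 2 * mism w ws := by
  induction hws generalizing α w with
  | nil => exact ⟨α, rfl, by simp at hw; simp [hw]⟩
  | @cons C js G ws hC _ ih =>
    cases w with
    | nil => simp at hw
    | cons j w =>
      obtain ⟨u, hu, hu'⟩ := hC
      rw [List.pairwise_cons] at hd
      have key : ∃ α', setNth (tab α vs) C j = tab α' vs ∧ (∀ D ∈ G, ∀ v ∈ D, α' v.2 = α v.2) ∧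
          dist vs α' αs + 1 ≤ dist vs α αs + 2 * (if j = js then 0 else 1) := by
        unfold setNth
        have hh := List.head?_drop (l := C) (i := j)
        cases hcj : C.drop j with
        -- The letter points beyond the end of the clause. It changes nothing, and it differs from
        -- the right letter, which points to a literal.
        | nil =>
          rw [hcj] at hh
          refine ⟨α, rfl, fun _ _ _ _ => rfl, ?_⟩
          rw [if_neg]
          · omega
          · rintro rfl; simp [hu] at hh
        | cons v r =>
          rw [hcj] at hh
          have hv : v ∈ C := List.mem_of_getElem? hh.symm
          refine ⟨Function.update α v.2 v.1, by rw [caseList_cons, setLit_tab], fun D hD x hx => ?_, ?_⟩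
          · rw [Function.update_of_ne fun h => hd.1 D hD v hv x hx h.symm]
          · split
            · rename_i hj
              subst hj
              obtain rfl : v = u := by simpa [hu] using hh
              exact dist_update_lt (hG C (by simp) v hv) (hf C (by simp) v hv) hu'
            · have := dist_update_le (vs := vs) (α := α) (αs := αs) (u := v)
              omega
      obtain ⟨α₁, e1, e2, e3⟩ := key
      obtain ⟨α', e4, e5⟩ := ih (α := α₁) w (fun D hD => hG D (by simp [hD]))
        (fun D hD v hv => by rw [e2 D hD v hv]; exact hf D (by simp [hD]) v hv) hd.2 (by simpa using hw)
      refine ⟨α', ?_, ?_⟩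
      · rw [← e4, ← e1]; rfl
      · simp only [List.length_cons, mism_cons]
        omega

include hF hk hs hS

/-- Induction on the rounds left. The guess `β` is fixed by the round in which the packing first
becomes small; earlier rounds do not read it, so they can take it from the induction hypothesis. -/
theorem exists_rounds (h2 : 2 ≤ k) (hd : t = d + 2 * s)
    (hcode : ∀ y : List ℕ, y.length = t → (∀ j ∈ y, j < k) →
      ∃ w ∈ S, w.length = t ∧ mism w y ≤ s) (m : ℕ) {α : X → Bool} (Z : List X)
    (hn : dist vs α αs ≤ d * m) :
    ∃ β : List Bool, β.length = k * t ∧ ∃ ws : List (List ℕ), ws.length = m ∧ (∀ w ∈ ws, w ∈ S) ∧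
      ∃ α', Sat F α' ∧ (ws.foldl (round t F β) (false, tab α vs, Z)).2.1 = tab α' vs := by
  induction m generalizing α Z with
  | zero =>
    exact ⟨List.replicate (k * t) false, by simp, [], rfl, by simp, α,
      sat_of_dist_eq_zero hF hs (by omega), rfl⟩
  | succ m ih =>
    obtain ⟨p1, p2, p3⟩ := packing_spec F (tab α vs)
    by_cases hG : ((packing F (tab α vs)).drop t).isEmpty = true
    · have hlen : (varsOf (packing F (tab α vs))).length ≤ k * t := by
        have h1 : (packing F (tab α vs)).length ≤ t := by simpa using hG
        have h2 : ∀ G : List (List (Bool × X)), (∀ C ∈ G, C.length ≤ k) →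
            (varsOf G).length ≤ k * G.length := by
          intro G
          induction G with
          | nil => simp [varsOf]
          | cons C G ih =>
            intro h
            have h3 := ih fun C hC => h C (by simp [hC])
            have h4 := h C (by simp)
            simp only [varsOf, List.length_map, List.flatten_cons, List.length_append,
              List.length_cons] at h3 ⊢
            rw [mul_add]; omega
        exact (h2 _ fun C hC => hk C (p1 C hC).1).trans (Nat.mul_le_mul_left _ h1)
      set V := varsOf (packing F (tab α vs)) with hV
      -- Padding to the fixed length `k * t` lets `β` range over a constant set; `zip` ignores the
      -- padding.
      let β := V.map αs ++ List.replicate (k * t - V.length) false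
      have hzip : β.zip V = V.map fun x => (αs x, x) := by
        have h1 : β.zip V = (V.map αs).zip V := by
          have := List.zip_append (l₁ := V.map αs) (r₁ := List.replicate (k * t - V.length) false)
            (l₂ := V) (r₂ := []) (by simp)
          simpa [β] using this
        rw [h1]
        clear_value V
        clear hV hlen β h1 p3
        induction V with
        | nil => rfl
        | cons x V ih => simp [ih]
      let α₁ := updates α (β.zip V)
      have hα₁ : ∀ x, α₁ x = if x ∈ V then αs x else α x := by
        intro x
        have := updates_apply_of_agree (α := α) (αs := αs) (β.zip V) (by rw [hzip]; simp) x
        rw [hzip] at this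
        simpa [α₁, hzip, Function.comp_def] using this
      -- A falsified clause that misses `V` was falsified before the freezing as well, against the
      -- maximality of the packing.
      have hZ : Frozen F αs α₁ V := by
        refine ⟨fun x hx => by simp [hα₁, hx], fun C hC hf => ?_⟩
        by_contra hc
        push Not at hc
        obtain ⟨u, hu, hu'⟩ := hs C hC
        obtain ⟨v, hv, hv'⟩ := p3 C hC ((falsified_tab (hF C hC)).2 fun u hu => by
          have := hf u hu
          rwa [hα₁, if_neg (hc u hu)] at this) (List.ne_nil_of_mem hu)
        exact hc v hv hv'
      have hdist : dist vs α₁ αs ≤ dist vs α αs := dist_le_of_imp fun x hx => by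
        rw [hα₁] at hx ⊢
        split <;> simp_all
      obtain ⟨w, w1, w2, α₂, Z₂, e1, e2, e3⟩ := exists_fixSteps hF hk hs h2 d hZ (n := d * m)
        (.inr (hdist.trans hn))
      obtain ⟨ws, v1, v2, α', e4, e5⟩ := exists_frozen_rounds (t := t) hF hk hs hS h2 β m e2 e3
      refine ⟨β, by simp [β]; omega, w :: ws, by simp [v1], by simpa [hS w w1 w2] using v2, α', e4, ?_⟩
      rw [List.foldl_cons, ← e5]
      simp only [round, freeze, hG, if_true, Bool.false_eq_true, if_false, setLits_tab, ← hV]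
      rw [show updates α (β.zip V) = α₁ from rfl, e1]
    · have hfr : ∀ β, freeze t F β (false, tab α vs, Z) = (false, tab α vs, Z) := fun β => by
        simp only [freeze, hG, Bool.false_eq_true, if_false]
      set G := packing F (tab α vs) with hGdef
      have hlen : t ≤ G.length := by
        by_contra h
        exact hG (by simp; omega)
      have hws : ∀ L : List (List (Bool × X)), (∀ C ∈ L, C ∈ F) → ∃ y : List ℕ, (∀ j ∈ y, j < k) ∧
          List.Forall₂ (fun C j => ∃ u, C[j]? = some u ∧ αs u.2 = u.1) L y := by
        intro L
        induction L with
        | nil => exact fun _ => ⟨[], by simp, .nil⟩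
        | cons C L ih =>
          intro h
          obtain ⟨y, y1, y2⟩ := ih fun C hC => h C (by simp [hC])
          obtain ⟨u, hu, hu'⟩ := hs C (h C (by simp))
          obtain ⟨j, hj, hju⟩ := List.mem_iff_getElem.1 hu
          refine ⟨j :: y, ?_, .cons ⟨u, by simp [hj, hju], hu'⟩ y2⟩
          have := hk C (h C (by simp))
          intro i hi
          rcases List.mem_cons.1 hi with rfl | hi
          · omega
          · exact y1 i hi
      have hsub : ∀ C ∈ G.take t, C ∈ G := fun C hC => List.mem_of_mem_take hC
      obtain ⟨y, y1, y2⟩ := hws (G.take t) fun C hC => (p1 C (hsub C hC)).1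
      have ylen : y.length = t := by rw [← y2.length_eq, List.length_take]; omega
      obtain ⟨w, c1, c2, c3⟩ := hcode y ylen y1
      obtain ⟨α₁, e1, e2⟩ := setWord_dist (α := α) (vs := vs) (G.take t) w y
        (fun C hC => hF C (p1 C (hsub C hC)).1)
        (fun C hC => (falsified_tab (hF C (p1 C (hsub C hC)).1)).1 (p1 C (hsub C hC)).2)
        (p2.sublist (List.take_sublist _ _)) y2 (by omega)
      -- `zip` stops at the end of `w`, so only the first `t` clauses of the packing are treated.
      have hset : setWord (tab α vs) G w = tab α₁ vs := by
        rw [← e1]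
        unfold setWord
        congr 1
        have := List.zip_append (l₁ := G.take t) (r₁ := G.drop t) (l₂ := w) (r₂ := [])
          (by rw [List.length_take]; omega)
        simpa using this
      obtain ⟨β, b1, ws, v1, v2, α', e4, e5⟩ := ih (α := α₁) Z (by rw [mul_add] at hn; omega)
      refine ⟨β, b1, w :: ws, by simp [v1], by simpa [c1] using v2, α', e4, ?_⟩
      rw [List.foldl_cons, ← e5]
      simp only [round, hfr, Bool.false_eq_true, if_false, ← hGdef, hset]

/-- Each of the `N` blocks contributes at most `d * q` to the initial distance and `q` rounds to the
search, each of which gains `d`. -/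
theorem exists_choices (h2 : 2 ≤ k) (hd : t = d + 2 * s)
    (hcode : ∀ y : List ℕ, y.length = t → (∀ j ∈ y, j < k) →
      ∃ w ∈ S, w.length = t ∧ mism w y ≤ s) (hv : vs.Nodup) {O : List (List Bool)} {b q : ℕ}
    (hO : ∀ y : List Bool, y.length = b → ∃ c ∈ O, c.length = b ∧ mism c y ≤ d * q) (N : ℕ)
    (hN : vs.length ≤ b * N) :
    ∃ (β : List Bool) (r : List (List Bool × List (List ℕ))), β.length = k * t ∧ r.length = N ∧
      (∀ x ∈ r, x.1 ∈ O ∧ x.2.length = q ∧ ∀ w ∈ x.2, w ∈ S) ∧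
      search t F vs ((β, []) :: r) ≠ none := by
  -- The last block may be incomplete; it is filled up with `false`.
  obtain ⟨cs, c1, c2, c3, c4⟩ := exists_blocks hO N
    (vs.map αs ++ List.replicate (b * N - vs.length) false) (by simp; omega)
  have hdist : dist vs (updates (fun _ => false) (cs.flatten.zip vs)) αs ≤ d * (q * N) := by
    rw [dist_eq_mism hv, map_updates_zip hv _ (by omega), ← mul_assoc]
    have h1 := mism_take cs.flatten (vs.map αs)
    rw [List.length_map] at h1
    rw [h1]
    exact (mism_le_append _ _ _).trans c4
  obtain ⟨β, b1, ws, w1, w2, α', e1, e2⟩ := exists_rounds hF hk hs hS h2 hd hcode (q * N) [] hdist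
  obtain ⟨gs, g1, g2, g3⟩ := exists_flatten_eq q N ws w1
  have m1 : (cs.zip gs).map Prod.fst = cs := List.map_fst_zip (by omega)
  have m2 : (cs.zip gs).map Prod.snd = gs := List.map_snd_zip (by omega)
  refine ⟨β, cs.zip gs, b1, by simp; omega, fun x hx => ?_, ?_⟩
  · have hx2 := (List.of_mem_zip hx).2
    exact ⟨c2 _ (List.of_mem_zip hx).1, g2 _ hx2,
      fun w hw => w2 w (g3 ▸ List.mem_flatten.2 ⟨_, hx2, hw⟩)⟩
  · have hwalk : walk t F vs β (cs.zip gs) = tab α' vs := by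
      unfold walk
      rw [show (vs.map fun x => (false, x)) = tab (fun _ => false) vs from rfl, setLits_tab, m1, m2,
        g3]
      exact e2
    have hall : (F.all fun C => !falsified (tab α' vs) C) = true := by
      rw [List.all_eq_true]
      intro C hC
      obtain ⟨u, hu, hu'⟩ := e1 C hC
      rw [Bool.not_eq_true', ← Bool.not_eq_true, falsified_tab (hF C hC)]
      push Not
      exact ⟨u, hu, hu'⟩
    simp only [search, caseList_cons, hwalk, hall, if_true]
    simp

end Rounds

theorem dedupVars_spec (F : List (List (Bool × X))) :
    (dedupVars F).Nodup ∧ ∀ x, x ∈ dedupVars F ↔ ∃ C ∈ F, ∃ u ∈ C, u.2 = x := by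
  have h : ∀ (l vs : List X), vs.Nodup →
      (l.foldl (fun vs x => if memVar vs x then vs else x :: vs) vs).Nodup ∧
      ∀ x, x ∈ l.foldl (fun vs x => if memVar vs x then vs else x :: vs) vs ↔ x ∈ vs ∨ x ∈ l := by
    intro l
    induction l with
    | nil => intro vs h; simp [h]
    | cons y l ih =>
      intro vs hvs
      rw [List.foldl_cons]
      split
      · rename_i hy
        rw [memVar_iff] at hy
        refine ⟨(ih vs hvs).1, fun x => ?_⟩
        rw [(ih vs hvs).2, List.mem_cons]
        constructor
        · tauto
        · rintro (h | rfl | h) <;> tauto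
      · rename_i hy
        rw [memVar_iff] at hy
        obtain ⟨h1, h2⟩ := ih (y :: vs) (List.nodup_cons.2 ⟨hy, hvs⟩)
        refine ⟨h1, fun x => ?_⟩
        rw [h2, List.mem_cons, List.mem_cons]
        tauto
  obtain ⟨h1, h2⟩ := h (varsOf F) [] List.nodup_nil
  refine ⟨h1, fun x => ?_⟩
  rw [← mem_varsOf]
  unfold dedupVars
  rw [h2]
  simp

end Correctness

/-! ### Covering codes -/

/-- The words of length `n` over an alphabet. -/
def words {B : Type} (l : List B) : ℕ → List (List B)
  | 0 => [[]]
  | n + 1 => l.flatMap fun a => (words l n).map (a :: ·)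

theorem length_words {B : Type} (l : List B) (n : ℕ) : (words l n).length = l.length ^ n := by
  induction n with
  | zero => rfl
  | succ n ih => simp [words, ih, List.length_flatMap, pow_succ, mul_comm]

theorem mem_words {B : Type} {l : List B} {n : ℕ} {w : List B} :
    w ∈ words l n ↔ w.length = n ∧ ∀ a ∈ w, a ∈ l := by
  induction n generalizing w with
  | zero =>
    simp only [words, List.mem_singleton, List.length_eq_zero_iff]
    constructor
    · rintro rfl; simp
    · exact fun h => h.1
  | succ n ih =>
    simp only [words, List.mem_flatMap, List.mem_map]
    constructor
    · rintro ⟨a, ha, v, hv, rfl⟩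
      obtain ⟨h1, h2⟩ := ih.1 hv
      exact ⟨by simp [h1], by simpa [ha] using h2⟩
    · rintro ⟨h1, h2⟩
      cases w with
      | nil => simp at h1
      | cons a v =>
        exact ⟨a, h2 a (by simp), v, ih.2 ⟨by simpa using h1, fun b hb => h2 b (by simp [hb])⟩, rfl⟩

/-- Greedy covering: if each point lies in at least `V` of the sets that are indexed by the
points, then few sets cover everything. -/
theorem exists_cover {W : Type} [Fintype W] [Nonempty W] (R : W → W → Prop)
    (V : ℕ) (h : ∀ y, V ≤ Nat.card {c // R c y}) (N : ℕ)
    (hN : (Fintype.card W : ℝ) * (1 - V / Fintype.card W) ^ N < 1) :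
    ∃ L : List W, L.length = N ∧ ∀ y, ∃ c ∈ L, R c y := by
  classical
  have hK : (0 : ℝ) < Fintype.card W := by exact_mod_cast Fintype.card_pos
  have hVK : (0 : ℝ) ≤ 1 - V / Fintype.card W := by
    have h1 : V ≤ Fintype.card W := by
      obtain ⟨y⟩ := ‹Nonempty W›
      refine (h y).trans ?_
      rw [← Nat.card_eq_fintype_card]
      exact Nat.card_le_card_of_injective _ Subtype.val_injective
    rw [sub_nonneg, div_le_one hK]
    exact_mod_cast h1
  have key : ∀ n, ∃ L : List W, L.length = n ∧
      ((Finset.univ.filter fun y => ∀ c ∈ L, ¬ R c y).card : ℝ) ≤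
        Fintype.card W * (1 - V / Fintype.card W) ^ n := by
    intro n
    induction n with
    | zero => exact ⟨[], rfl, by simp⟩
    | succ n ih =>
      obtain ⟨L, h1, h2⟩ := ih
      set U := Finset.univ.filter fun y => ∀ c ∈ L, ¬ R c y with hU
      -- Double counting of the pairs of a center and an uncovered point related by `R`. By
      -- averaging, some center covers at least the fraction `V / Fintype.card W` of `U`.
      have hsum : V * U.card ≤ ∑ c : W, (U.filter fun y => R c y).card := by
        simp only [Finset.card_filter]
        rw [Finset.sum_comm]
        calc V * U.card = ∑ y ∈ U, V := by rw [Finset.sum_const, smul_eq_mul, mul_comm]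
          _ ≤ _ := Finset.sum_le_sum fun y _ => by
            refine (h y).trans ?_
            rw [← Finset.card_filter, Nat.card_eq_fintype_card, Fintype.card_subtype]
      obtain ⟨c, hc⟩ : ∃ c : W, V * U.card ≤ Fintype.card W * (U.filter fun y => R c y).card := by
        by_contra hcon
        push Not at hcon
        have h3 : ∑ c : W, Fintype.card W * (U.filter fun y => R c y).card
            < ∑ _c : W, V * U.card :=
          Finset.sum_lt_sum_of_nonempty Finset.univ_nonempty fun c _ => hcon c
        rw [← Finset.mul_sum, Finset.sum_const, Finset.card_univ, smul_eq_mul] at h3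
        exact absurd h3 (not_lt.2 (Nat.mul_le_mul_left _ hsum))
      refine ⟨c :: L, by simp [h1], ?_⟩
      have h4 : (Finset.univ.filter fun y => ∀ c' ∈ c :: L, ¬ R c' y) = U.filter fun y => ¬ R c y := by
        ext y; simp [hU, and_comm]
      have h5 := Finset.card_filter_add_card_filter_not (s := U) fun y => R c y
      rw [h4, pow_succ, ← mul_assoc]
      refine le_trans ?_ (mul_le_mul_of_nonneg_right h2 hVK)
      have h6 : ((U.filter fun y => R c y).card : ℝ) + (U.filter fun y => ¬ R c y).card = U.card := by
        exact_mod_cast h5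
      have h7 : (V : ℝ) * U.card ≤ Fintype.card W * (U.filter fun y => R c y).card := by
        exact_mod_cast hc
      have h8 : (U.card : ℝ) * (V / Fintype.card W) ≤ (U.filter fun y => R c y).card := by
        rw [← mul_div_assoc, div_le_iff₀ hK]; linarith
      linarith
  obtain ⟨L, h1, h2⟩ := key N
  refine ⟨L, h1, fun y => ?_⟩
  by_contra hy
  push Not at hy
  have h3 : 0 < (Finset.univ.filter fun y => ∀ c ∈ L, ¬ R c y).card :=
    Finset.card_pos.2 ⟨y, by simpa using hy⟩
  have h4 : (1 : ℝ) ≤ (Finset.univ.filter fun y => ∀ c ∈ L, ¬ R c y).card := by exact_mod_cast h3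
  linarith

theorem mism_ofFn {B : Type} [DecidableEq B] {t : ℕ} (f g : Fin t → B) :
    mism (List.ofFn f) (List.ofFn g) + ∑ i, (if f i = g i then 1 else 0) = t := by
  induction t with
  | zero => simp
  | succ t ih =>
    rw [List.ofFn_succ, List.ofFn_succ, mism_cons, Fin.sum_univ_succ]
    have := ih (fun i => f i.succ) fun i => g i.succ
    split <;> omega

open Polynomial in
/-- The number of words that agree with a given word at `t - s` positions. -/
theorem card_agree (k t s : ℕ) (hs : s ≤ t) (y : Fin t → Fin k) :
    Nat.card {c : Fin t → Fin k // ∑ i, (if c i = y i then 1 else 0) = t - s}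
      = t.choose s * (k - 1) ^ s := by
  -- Generating function for the number of agreements: each position contributes `X` for the one
  -- agreeing letter and `1` for each of the other `k - 1`.
  have h1 : ∑ c : Fin t → Fin k, (X : ℕ[X]) ^ (∑ i, if c i = y i then 1 else 0)
      = (X + C (k - 1)) ^ t := by
    have h2 : ∀ i, ∑ a : Fin k, (X : ℕ[X]) ^ (if a = y i then 1 else 0) = X + C (k - 1) := by
      intro i
      rw [← Finset.add_sum_erase _ _ (Finset.mem_univ (y i)), if_pos rfl, pow_one]
      congr 1
      rw [Finset.sum_congr rfl fun a ha => by rw [if_neg (Finset.ne_of_mem_erase ha), pow_zero]]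
      simp
    calc _ = ∑ c : Fin t → Fin k, ∏ i, (X : ℕ[X]) ^ (if c i = y i then 1 else 0) := by
          simp only [Finset.prod_pow_eq_pow_sum]
      _ = ∏ i : Fin t, ∑ a : Fin k, (X : ℕ[X]) ^ (if a = y i then 1 else 0) := by
          rw [Finset.prod_univ_sum, Fintype.piFinset_univ]
      _ = _ := by simp only [h2, Finset.prod_const, Finset.card_univ, Fintype.card_fin]
  have h3 := congrArg (fun p => p.coeff (t - s)) h1
  simp only [finsetSum_coeff, coeff_X_pow, coeff_X_add_C_pow] at h3
  rw [Nat.card_eq_fintype_card, Fintype.card_subtype, Finset.card_filter]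
  rw [Nat.sub_sub_self hs, Nat.choose_symm hs] at h3
  rw [mul_comm]
  simpa [eq_comm] using h3

/-- A covering code of nearly optimal size. -/
theorem exists_code (k t s : ℕ) (hk : 2 ≤ k) (hs : s ≤ t) :
    ∃ L : List (List ℕ), (∀ y : List ℕ, y.length = t → (∀ j ∈ y, j < k) →
        ∃ w ∈ L, w.length = t ∧ mism w y ≤ s) ∧
      (L.length : ℝ) ≤ (k : ℝ) ^ t / (t.choose s * ((k : ℝ) - 1) ^ s) * (t * k + 1) := by
  have : NeZero k := ⟨by omega⟩
  let W := Fin t → Fin k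
  set V := t.choose s * (k - 1) ^ s with hV
  have hV0 : 0 < V := Nat.mul_pos (Nat.choose_pos hs) (Nat.pow_pos (by omega))
  have hcard : Fintype.card W = k ^ t := by simp [W]
  have hcast : (V : ℝ) = t.choose s * ((k : ℝ) - 1) ^ s := by
    rw [hV]; push_cast [Nat.cast_sub (show 1 ≤ k by omega)]; ring
  have hK : (0 : ℝ) < (k : ℝ) ^ t := by positivity
  have hVpos : (0 : ℝ) < V := by exact_mod_cast hV0
  have hVK : (V : ℝ) ≤ (k : ℝ) ^ t := by
    have h1 := card_agree k t s hs fun _ => 0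
    have h2 : V ≤ Nat.card W := by
      rw [hV, ← h1]; exact Nat.card_le_card_of_injective _ Subtype.val_injective
    rw [Nat.card_eq_fintype_card, hcard] at h2
    exact_mod_cast h2
  -- With `K = k ^ t`, this `N` exceeds `(K / V) * log K`, hence `K * (1 - V / K) ^ N ≤ K * exp (-N
  -- * V / K) < 1`.
  set N := ⌊(k : ℝ) ^ t / V * Real.log ((k : ℝ) ^ t)⌋₊ + 1 with hN
  have hlog : 0 ≤ Real.log ((k : ℝ) ^ t) :=
    Real.log_nonneg (one_le_pow₀ (by exact_mod_cast (show 1 ≤ k by omega)))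
  obtain ⟨L, h1, h2⟩ := exists_cover (W := W)
    (fun c y => ∑ i, (if c i = y i then 1 else 0) = t - s) V
    (fun y => (card_agree k t s hs y).ge) N (by
      rw [hcard]; push_cast
      have e1 : 1 - (V : ℝ) / (k : ℝ) ^ t ≤ Real.exp (-(V / (k : ℝ) ^ t)) :=
        Real.one_sub_le_exp_neg _
      have e0 : 0 ≤ 1 - (V : ℝ) / (k : ℝ) ^ t := by
        rw [sub_nonneg, div_le_one hK]; exact hVK
      have e2 := pow_le_pow_left₀ e0 e1 N
      rw [← Real.exp_nat_mul] at e2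
      have e3 : Real.log ((k : ℝ) ^ t) < N * (V / (k : ℝ) ^ t) := by
        have := Nat.lt_floor_add_one ((k : ℝ) ^ t / V * Real.log ((k : ℝ) ^ t))
        rw [← div_lt_iff₀ (by positivity)]
        calc _ = (k : ℝ) ^ t / V * Real.log ((k : ℝ) ^ t) := by field_simp
          _ < _ := by rw [hN]; push_cast; exact this
      calc (k : ℝ) ^ t * (1 - (V : ℝ) / (k : ℝ) ^ t) ^ N
          ≤ (k : ℝ) ^ t * Real.exp (N * -(V / (k : ℝ) ^ t)) := by gcongr
        _ < (k : ℝ) ^ t * Real.exp (-Real.log ((k : ℝ) ^ t)) := by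
          gcongr; linarith
        _ = 1 := by rw [Real.exp_neg, Real.exp_log hK]; field_simp)
  refine ⟨L.map fun c => List.ofFn fun i => (c i : ℕ), fun y hy hyk => ?_, ?_⟩
  · subst hy
    obtain ⟨c, hc, hcy⟩ := h2 fun i => ⟨y[i], hyk _ (List.getElem_mem _)⟩
    refine ⟨_, List.mem_map.2 ⟨c, hc, rfl⟩, by simp, ?_⟩
    have h3 := mism_ofFn (fun i => (c i : ℕ)) fun i => y[i]
    have h4 : List.ofFn (fun i : Fin y.length => y[i]) = y := List.ofFn_getElem
    rw [h4] at h3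
    simp only [Fin.ext_iff] at hcy
    rw [hcy] at h3
    omega
  · rw [List.length_map, h1, ← hcast, hN]
    push_cast
    have h3 : Real.log ((k : ℝ) ^ t) ≤ t * k := by
      rw [Real.log_pow]
      gcongr
      exact (Real.log_le_sub_one_of_pos (by positivity)).trans (by linarith)
    have h4 : 1 ≤ (k : ℝ) ^ t / V := by rwa [one_le_div hVpos]
    have h5 := Nat.floor_le (show 0 ≤ (k : ℝ) ^ t / V * Real.log ((k : ℝ) ^ t) by positivity)
    calc _ ≤ (k : ℝ) ^ t / V * Real.log ((k : ℝ) ^ t) + (k : ℝ) ^ t / V := add_le_add h5 h4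
      _ = (k : ℝ) ^ t / V * (Real.log ((k : ℝ) ^ t) + 1) := by ring
      _ ≤ _ := by gcongr

/-! ### Sizes of the codes -/

/-- The largest term of the binomial expansion of `(a + b) ^ ((a + b) * m)`. -/
theorem pow_le_choose_mul (a b m : ℕ) (hb : 0 < b) :
    (a + b) ^ ((a + b) * m) ≤
      ((a + b) * m + 1) * (((a + b) * m).choose (a * m) * a ^ (a * m) * b ^ (b * m)) := by
  set n := (a + b) * m with hn
  let f : ℕ → ℕ := fun d => n.choose d * a ^ d * b ^ (n - d)
  -- The ratio of consecutive terms is `(n - d) * a / ((d + 1) * b)`: at least 1 for `d < a * m` and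
  -- at most 1 from there on, so the term at `a * m` is the largest.
  have hf : ∀ d < n, f (d + 1) * ((d + 1) * b) = f d * ((n - d) * a) := by
    intro d hd
    have h1 := Nat.choose_succ_right_eq n d
    have h2 : n - d = (n - (d + 1)) + 1 := by omega
    simp only [f]
    calc _ = (n.choose (d + 1) * (d + 1)) * a ^ (d + 1) * (b ^ (n - (d + 1)) * b) := by ring
      _ = (n.choose d * (n - d)) * a ^ (d + 1) * b ^ (n - d) := by rw [h1, ← pow_succ, ← h2]
      _ = _ := by ring
  have hn' : n = a * m + b * m := by rw [hn, add_mul]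
  have up : ∀ j, j ≤ a * m → f (a * m - j) ≤ f (a * m) := by
    intro j
    induction j with
    | zero => simp
    | succ j ih =>
      intro hj
      refine le_trans ?_ (ih (by omega))
      have h1 := hf (a * m - (j + 1)) (by omega)
      rw [show a * m - (j + 1) + 1 = a * m - j by omega] at h1
      refine Nat.le_of_mul_le_mul_right (h1 ▸ Nat.mul_le_mul_left _ ?_)
        (Nat.mul_pos (show 0 < a * m - j by omega) hb)
      calc (a * m - j) * b ≤ (a * m) * b := Nat.mul_le_mul_right _ (by omega)
        _ = (b * m) * a := by ring
        _ ≤ _ := Nat.mul_le_mul_right _ (by omega)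
  have down : ∀ j, a * m + j ≤ n → f (a * m + j) ≤ f (a * m) := by
    intro j
    induction j with
    | zero => simp
    | succ j ih =>
      intro hj
      refine le_trans ?_ (ih (by omega))
      have h1 := hf (a * m + j) (by omega)
      refine Nat.le_of_mul_le_mul_right (h1.trans_le (Nat.mul_le_mul_left _ ?_))
        (Nat.mul_pos (show 0 < a * m + j + 1 by omega) hb)
      calc (n - (a * m + j)) * a ≤ (b * m) * a := Nat.mul_le_mul_right _ (by omega)
        _ = (a * m) * b := by ring
        _ ≤ _ := Nat.mul_le_mul_right _ (by omega)
  have hmax : ∀ d ≤ n, f d ≤ f (a * m) := by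
    intro d hd
    rcases le_total d (a * m) with h | h
    · have := up (a * m - d) (by omega)
      rwa [show a * m - (a * m - d) = d by omega] at this
    · have := down (d - a * m) (by omega)
      rwa [show a * m + (d - a * m) = d by omega] at this
  have hfam : f (a * m) = n.choose (a * m) * a ^ (a * m) * b ^ (b * m) := by
    simp only [f]; rw [show n - a * m = b * m by omega]
  rw [add_pow, ← hfam]
  calc _ = ∑ d ∈ Finset.range (n + 1), f d :=
        Finset.sum_congr rfl fun d _ => by simp only [f, Nat.cast_id]; ring
    _ ≤ ∑ d ∈ Finset.range (n + 1), f (a * m) :=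
        Finset.sum_le_sum fun d hd => hmax d (by simpa [Nat.lt_succ_iff] using hd)
    _ = _ := by simp

theorem exists_quadratic_le_pow (A : ℝ) {r : ℝ} (hr : 1 < r) :
    ∃ m : ℕ, 1 ≤ m ∧ A * (m : ℝ) ^ 2 ≤ r ^ m := by
  have h1 := (tendsto_pow_const_div_const_pow_of_one_lt 2 hr).const_mul A
  rw [mul_zero] at h1
  obtain ⟨m, hm, hm1⟩ := ((h1.eventually (gt_mem_nhds one_pos)).and
    (Filter.eventually_ge_atTop 1)).exists
  refine ⟨m, hm1, ?_⟩
  have hp : 0 < r ^ m := by positivity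
  rw [← mul_div_assoc, div_lt_one hp] at hm
  exact hm.le

/-- The ratio between the number of words and the size of a sphere. -/
theorem sphere_ratio_le (k m : ℕ) (hk : 2 ≤ k) (l : ℝ) (hl : 0 ≤ l) :
    l ^ (k * m) / ((k * m).choose m) ≤
      (k * m + 1) * (l ^ (k * m) * ((k : ℝ) - 1) ^ ((k - 1) * m) / (k : ℝ) ^ (k * m)) := by
  have h := pow_le_choose_mul 1 (k - 1) m (by omega)
  rw [show 1 + (k - 1) = k by omega] at h
  simp only [one_mul, one_pow, mul_one] at h
  have hc : (0 : ℝ) < (k * m).choose m := by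
    exact_mod_cast Nat.choose_pos (Nat.le_mul_of_pos_left _ (by omega))
  have hk0 : (0 : ℝ) < (k : ℝ) ^ (k * m) := by positivity
  have h' : (k : ℝ) ^ (k * m) ≤
      (k * m + 1) * ((k * m).choose m * ((k : ℝ) - 1) ^ ((k - 1) * m)) := by
    have : ((k ^ (k * m) : ℕ) : ℝ) ≤ _ := Nat.cast_le.2 h
    push_cast [Nat.cast_sub (show 1 ≤ k by omega)] at this
    exact this
  rw [div_le_iff₀ hc]
  calc l ^ (k * m) = l ^ (k * m) * ((k : ℝ) ^ (k * m) / (k : ℝ) ^ (k * m)) := by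
        rw [div_self hk0.ne', mul_one]
    _ ≤ l ^ (k * m) * ((k * m + 1) * ((k * m).choose m * ((k : ℝ) - 1) ^ ((k - 1) * m))
        / (k : ℝ) ^ (k * m)) := by gcongr
    _ = _ := by ring

/-- Codes for the local search: covering codes with a small number of words in relation to the
progress `d` that they guarantee, together with all words of length `d` over `k - 1` letters. -/
theorem exists_inner_code (k : ℕ) (hk : 2 ≤ k) (l : ℝ) (hl : (k : ℝ) - 1 < l) :
    ∃ (t s d : ℕ) (S : List (List ℕ)), 1 ≤ d ∧ t = d + 2 * s ∧
      (∀ w : List ℕ, w.length = d → (∀ j ∈ w, j < k - 1) → w ∈ S) ∧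
      (∀ y : List ℕ, y.length = t → (∀ j ∈ y, j < k) → ∃ w ∈ S, w.length = t ∧ mism w y ≤ s) ∧
      (S.length : ℝ) ≤ l ^ d := by
  have hk1 : (1 : ℝ) ≤ (k : ℝ) - 1 := by
    have : (2 : ℝ) ≤ k := by exact_mod_cast hk
    linarith
  -- It suffices to have parameters proportional to `m` for which the sphere bound is `μ ^ d` with
  -- `μ < l`, up to a factor linear in `t`. All polynomial factors are then absorbed by `(l / μ) ^
  -- d` for some `m`, since `d ≥ m`.
  suffices H : ∃ (c : ℕ) (μ : ℝ), (k : ℝ) - 1 ≤ μ ∧ μ < l ∧ ∀ m : ℕ, 1 ≤ m → ∃ t s d : ℕ,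
      t = c * m ∧ m ≤ d ∧ t = d + 2 * s ∧
      (k : ℝ) ^ t / (t.choose s * ((k : ℝ) - 1) ^ s) ≤ (t + 1) * μ ^ d by
    obtain ⟨c, μ, h1, h2, h3⟩ := H
    have hμ : 0 < μ := by linarith
    obtain ⟨m, hm1, hm⟩ := exists_quadratic_le_pow ((c + 1) * (c * k + 1) + 1)
      (show 1 < l / μ by rwa [one_lt_div hμ])
    obtain ⟨t, s, d, e1, e2, e3, e4⟩ := h3 m hm1
    obtain ⟨L, hL1, hL2⟩ := exists_code k t s hk (by omega)
    refine ⟨t, s, d, L ++ words (List.range (k - 1)) d, by omega, e3, fun w hw hj => ?_,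
      fun y hy hj => ?_, ?_⟩
    · exact List.mem_append_right _ (mem_words.2 ⟨hw, fun a ha => List.mem_range.2 (hj a ha)⟩)
    · obtain ⟨w, hw, hw'⟩ := hL1 y hy hj
      exact ⟨w, List.mem_append_left _ hw, hw'⟩
    · rw [List.length_append, length_words, List.length_range]
      push_cast [Nat.cast_sub (show 1 ≤ k by omega)]
      have hm' : (1 : ℝ) ≤ m := by exact_mod_cast hm1
      have ht : (t : ℝ) = c * m := by exact_mod_cast e1
      have h5 : (L.length : ℝ) ≤ (t + 1) * μ ^ d * (t * k + 1) := hL2.trans (by gcongr)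
      have h6 : ((k : ℝ) - 1) ^ d ≤ μ ^ d := pow_le_pow_left₀ (by linarith) h1 d
      have h7 : ((t : ℝ) + 1) * (t * k + 1) + 1 ≤ (l / μ) ^ d := by
        have e5 : ((t : ℝ) + 1) * (t * k + 1) + 1 ≤ ((c + 1) * (c * k + 1) + 1) * (m : ℝ) ^ 2 := by
          have a1 : (t : ℝ) + 1 ≤ (c + 1) * m := by rw [ht]; linarith
          have a2 : (t : ℝ) * k + 1 ≤ (c * k + 1) * m := by rw [ht]; nlinarith
          have a3 : (1 : ℝ) ≤ (m : ℝ) ^ 2 := one_le_pow₀ hm'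
          calc _ ≤ ((c + 1) * m) * ((c * k + 1) * m) + (m : ℝ) ^ 2 := by gcongr
            _ = _ := by ring
        exact (e5.trans hm).trans (pow_le_pow_right₀ (by rw [le_div_iff₀ hμ]; linarith) e2)
      calc _ ≤ (t + 1) * μ ^ d * (t * k + 1) + μ ^ d := add_le_add h5 h6
        _ = (((t : ℝ) + 1) * (t * k + 1) + 1) * μ ^ d := by ring
        _ ≤ (l / μ) ^ d * μ ^ d := by gcongr
        _ = l ^ d := by rw [← mul_pow, div_mul_cancel₀ _ hμ.ne']
  rcases hk.lt_or_eq with hk3 | rfl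
  -- For `k ≥ 3` the radius is `t / k`: the ratio is about `(k - 1) ^ ((k - 1) * m) / (k - 1) ^ m`,
  -- which is `(k - 1) ^ d`.
  · refine ⟨k, (k : ℝ) - 1, le_rfl, hl, fun m hm => ⟨k * m, m, (k - 2) * m, rfl, ?_, ?_, ?_⟩⟩
    · exact Nat.le_mul_of_pos_left _ (by omega)
    · rw [← add_mul]; congr 1; omega
    · have h1 := sphere_ratio_le k m hk k (by positivity)
      have hk0 : (0 : ℝ) < (k : ℝ) ^ (k * m) := by positivity
      have hkp : (0 : ℝ) < ((k : ℝ) - 1) ^ m := by positivity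
      rw [mul_div_cancel_left₀ _ hk0.ne'] at h1
      rw [← div_div, div_le_iff₀ hkp]
      refine h1.trans (le_of_eq ?_)
      rw [mul_assoc, ← pow_add]
      push_cast
      congr 2
      have : k - 1 = (k - 2) + 1 := by omega
      rw [this]; ring
  -- For `k = 2` that radius would give `d = 0`. Instead `s / t = (j - 1) / (2 * j)`, at a price of
  -- `1 + 1 / j` per unit of progress, which is below `l` for large `j`.
  · obtain ⟨j, hj⟩ := exists_nat_gt (max 2 (1 / (l - 1)))
    rw [max_lt_iff] at hj
    norm_num at hl hk1
    obtain ⟨hj2, hjl⟩ := hj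
    have hj2' : 2 < j := by exact_mod_cast hj2
    have hl1 : 0 < l - 1 := by linarith
    have hj0 : (0 : ℝ) < j := by linarith
    refine ⟨2 * j, 1 + 1 / j, ?_, ?_, fun m hm => ⟨2 * j * m, (j - 1) * m, 2 * m, rfl, by omega, ?_, ?_⟩⟩
    · have : (0 : ℝ) < 1 / j := by positivity
      norm_num
    · rw [div_lt_iff₀ hl1] at hjl
      have : 1 / (j : ℝ) < l - 1 := by rw [div_lt_iff₀ hj0]; linarith
      linarith
    · obtain ⟨i, rfl⟩ : ∃ i, j = i + 1 := ⟨j - 1, by omega⟩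
      simp only [Nat.add_sub_cancel]; ring
    · obtain ⟨i, rfl⟩ : ∃ i, j = i + 1 := ⟨j - 1, by omega⟩
      have h1 := pow_le_choose_mul i (i + 2) m (by omega)
      rw [show i + (i + 2) = 2 * (i + 1) by ring] at h1
      simp only [Nat.add_sub_cancel]
      have hc : (0 : ℝ) < (2 * (i + 1) * m).choose (i * m) := by
        exact_mod_cast Nat.choose_pos (Nat.mul_le_mul_right _ (by omega))
      norm_num
      rw [div_le_iff₀ hc]
      have h2 : ((2 * (i + 1) : ℕ) : ℝ) ^ (2 * (i + 1) * m) ≤ ((2 * (i + 1) * m : ℕ) + 1) *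
          ((2 * (i + 1) * m).choose (i * m) * (i : ℝ) ^ (i * m) * ((i : ℝ) + 2) ^ ((i + 2) * m)) := by
        exact_mod_cast h1
      -- Pair the factors `i` with as many factors `i + 2` and use `i * (i + 2) ≤ (i + 1) ^ 2`; the
      -- `2 * m` factors left over give the power of `1 + 1 / (i + 1)`.
      have h3 : (i : ℝ) ^ (i * m) * ((i : ℝ) + 2) ^ ((i + 2) * m) ≤
          ((i : ℝ) + 1) ^ (2 * (i + 1) * m) * (1 + ((i : ℝ) + 1)⁻¹) ^ (2 * m) := by
        have e1 : 1 + ((i : ℝ) + 1)⁻¹ = (i + 2) / (i + 1) := by field_simp; ring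
        have e2 : (i : ℝ) * (i + 2) ≤ (i + 1) ^ 2 := by nlinarith
        calc (i : ℝ) ^ (i * m) * ((i : ℝ) + 2) ^ ((i + 2) * m)
            = ((i : ℝ) * (i + 2)) ^ (i * m) * (i + 2) ^ (2 * m) := by
              rw [mul_pow, mul_assoc, ← pow_add]; ring_nf
          _ ≤ (((i : ℝ) + 1) ^ 2) ^ (i * m) * (i + 2) ^ (2 * m) := by gcongr
          _ = _ := by
              rw [e1, div_pow, ← pow_mul, show 2 * (i + 1) * m = 2 * (i * m) + 2 * m by ring, pow_add]
              field_simp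
      have h4 : (0 : ℝ) < ((i : ℝ) + 1) ^ (2 * (i + 1) * m) := by positivity
      refine le_of_mul_le_mul_right ?_ h4
      calc (2 : ℝ) ^ (2 * (i + 1) * m) * ((i : ℝ) + 1) ^ (2 * (i + 1) * m)
          = ((2 * (i + 1) : ℕ) : ℝ) ^ (2 * (i + 1) * m) := by rw [← mul_pow]; push_cast; rfl
        _ ≤ _ := h2
        _ = ((2 * (i + 1) * m : ℕ) + 1) * (2 * (i + 1) * m).choose (i * m) *
            ((i : ℝ) ^ (i * m) * ((i : ℝ) + 2) ^ ((i + 2) * m)) := by ring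
        _ ≤ ((2 * (i + 1) * m : ℕ) + 1) * (2 * (i + 1) * m).choose (i * m) *
            (((i : ℝ) + 1) ^ (2 * (i + 1) * m) * (1 + ((i : ℝ) + 1)⁻¹) ^ (2 * m)) := by gcongr
        _ = _ := by push_cast; ring

/-- Since `f` undoes `g`, decoding keeps every agreement with an encoded word and may only create
new ones. This turns a code over the letters `0` and `1` into one over `Bool`. -/
theorem mism_map_le {B D : Type} [DecidableEq B] [DecidableEq D] (f : B → D) (g : D → B)
    (h : ∀ d, f (g d) = d) (w : List B) (y : List D) : mism (w.map f) y ≤ mism w (y.map g) := by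
  induction w generalizing y with
  | nil => simp
  | cons a w ih =>
    cases y with
    | nil => simp
    | cons b y =>
      simp only [List.map_cons, mism_cons]
      have := ih y
      by_cases h1 : a = g b
      · simp [h1, h, this]
      · rw [if_neg h1]; split <;> omega

/-- Codes for the whole algorithm. -/
theorem exists_codes (k : ℕ) (hk : 2 ≤ k) (a : ℝ) (ha : 2 * ((k : ℝ) - 1) / k < a) :
    ∃ (t s d q b : ℕ) (S : List (List ℕ)) (O : List (List Bool)), 0 < b ∧ t = d + 2 * s ∧
      (∀ w : List ℕ, w.length = d → (∀ j ∈ w, j < k - 1) → w ∈ S) ∧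
      (∀ y : List ℕ, y.length = t → (∀ j ∈ y, j < k) → ∃ w ∈ S, w.length = t ∧ mism w y ≤ s) ∧
      (∀ y : List Bool, y.length = b → ∃ c ∈ O, c.length = b ∧ mism c y ≤ d * q) ∧
      (O.length : ℝ) * (S.length : ℝ) ^ q ≤ a ^ b := by
  have hk2 : (2 : ℝ) ≤ k := by exact_mod_cast hk
  have hk1 : (0 : ℝ) < (k : ℝ) - 1 := by linarith
  set a₀ := 2 * ((k : ℝ) - 1) / k with ha₀
  have ha₀p : 0 < a₀ := by positivity
  -- Then `a₀ * ρ` is the midpoint of `a₀` and `a`. The factor `ρ` is the slack of the inner code,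
  -- and `a / (a₀ * ρ)` pays for the polynomial factors of the outer one.
  set ρ := (1 + a / a₀) / 2 with hρ
  have h1 : 1 < a / a₀ := by rwa [one_lt_div ha₀p]
  have hρ1 : 1 < ρ := by rw [hρ]; linarith
  have hρa : a₀ * ρ < a := by
    have : a₀ * (a / a₀) = a := by field_simp
    rw [hρ]; nlinarith
  obtain ⟨t, s, d, S, hd, e1, e2, e3, e4⟩ := exists_inner_code k hk (((k : ℝ) - 1) * ρ) (by nlinarith)
  have hap : 0 < a₀ * ρ := by positivity
  obtain ⟨m, hm1, hm⟩ := exists_quadratic_le_pow (((k * d : ℕ) + 1) * (2 * (k * d : ℕ) + 1))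
    (show 1 < a / (a₀ * ρ) by rwa [one_lt_div hap])
  have hr0 : (1 : ℝ) ≤ a / (a₀ * ρ) := by rw [one_le_div hap]; exact hρa.le
  -- The radius is `1 / k` of the block length, and it is exactly what `m` rounds with progress `d`
  -- remove.
  obtain ⟨L, hL1, hL2⟩ := exists_code 2 (k * (d * m)) (d * m) le_rfl
    (Nat.le_mul_of_pos_left _ (by omega))
  refine ⟨t, s, d, m, k * (d * m), S, L.map fun w => w.map fun i => decide (i = 1), by positivity, e1,
    e2, e3, fun y hy => ?_, ?_⟩
  · obtain ⟨w, hw, hwl, hwm⟩ := hL1 (y.map fun x => x.toNat) (by simpa using hy) (by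
      intro j hj
      obtain ⟨x, -, rfl⟩ := List.mem_map.1 hj
      cases x <;> simp)
    exact ⟨_, List.mem_map.2 ⟨w, hw, rfl⟩, by simpa using hwl,
      (mism_map_le _ (fun x : Bool => x.toNat) (by decide) w y).trans hwm⟩
  · rw [List.length_map]
    set n := d * m with hn
    set b := k * n with hb
    have h5 := sphere_ratio_le k n hk 2 (by norm_num)
    norm_num at hL2
    have h6 : (S.length : ℝ) ^ m ≤ (((k : ℝ) - 1) * ρ) ^ n := by
      rw [hn, pow_mul]; exact pow_le_pow_left₀ (by positivity) e4 m
    have h7 : (L.length : ℝ) ≤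
        (b + 1) * (2 ^ b * ((k : ℝ) - 1) ^ ((k - 1) * n) / (k : ℝ) ^ b) * (2 * b + 1) := by
      have hbr : (b : ℝ) = k * n := by rw [hb]; push_cast; rfl
      rw [← hbr] at h5
      refine hL2.trans ?_
      rw [mul_comm (b : ℝ) 2]
      gcongr
    have h8 : (((k : ℝ) - 1) * ρ) ^ n ≤ ((k : ℝ) - 1) ^ n * ρ ^ b := by
      rw [mul_pow]
      gcongr
      · exact hρ1.le
      · exact Nat.le_mul_of_pos_left _ (by omega)
    have h9 : ((b : ℝ) + 1) * (2 * b + 1) ≤ (a / (a₀ * ρ)) ^ b := by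
      have hm' : (1 : ℝ) ≤ m := by exact_mod_cast hm1
      have hbm : (b : ℝ) = (k * d : ℕ) * m := by rw [hb, hn]; push_cast; ring
      have a1 : ((b : ℝ) + 1) * (2 * b + 1) ≤
          (((k * d : ℕ) + 1) * (2 * (k * d : ℕ) + 1)) * (m : ℝ) ^ 2 := by
        have b1 : (b : ℝ) + 1 ≤ ((k * d : ℕ) + 1) * m := by rw [hbm]; linarith
        have b2 : 2 * (b : ℝ) + 1 ≤ (2 * (k * d : ℕ) + 1) * m := by rw [hbm]; linarith
        calc _ ≤ (((k * d : ℕ) + 1) * (m : ℝ)) * ((2 * (k * d : ℕ) + 1) * m) := by gcongr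
          _ = _ := by ring
      refine (a1.trans hm).trans (pow_le_pow_right₀ hr0 ?_)
      rw [hb, hn, ← mul_assoc]
      exact Nat.le_mul_of_pos_left _ (by positivity)
    clear_value ρ
    calc (L.length : ℝ) * (S.length : ℝ) ^ m
        ≤ ((b + 1) * (2 ^ b * ((k : ℝ) - 1) ^ ((k - 1) * n) / (k : ℝ) ^ b) * (2 * b + 1)) *
          (((k : ℝ) - 1) ^ n * ρ ^ b) := by
          gcongr
          exact h6.trans h8
      _ = ((b : ℝ) + 1) * (2 * b + 1) * (a₀ * ρ) ^ b := by
          -- The powers of `k - 1` from the outer and the inner code combine to `(k - 1) ^ b`.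
          have : b = (k - 1) * n + n := by
            rw [hb, ← Nat.succ_mul]; congr 1; omega
          have h10 : ((k : ℝ) - 1) ^ b = ((k : ℝ) - 1) ^ ((k - 1) * n) * ((k : ℝ) - 1) ^ n := by
            conv_lhs => rw [this, pow_add]
          rw [ha₀, mul_pow, div_pow, mul_pow, h10]
          ring
      _ ≤ (a / (a₀ * ρ)) ^ b * (a₀ * ρ) ^ b := by gcongr
      _ = a ^ b := by rw [← mul_pow, div_mul_cancel₀ _ hap.ne']

/-! ### The program -/

/-- The options for the blocks of variables: one copy of `x` for each `b` variables. -/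
def blocks {X O : Type} (b : ℕ) (x : O) (vs : List X) : List O :=
  -- The list of units counts the variables still to be read in the current block. A copy is emitted
  -- whenever it is empty, so an incomplete last block gets one too.
  (vs.foldl (fun (st : List Unit × List O) _ =>
    caseList st.1 (List.replicate (b - 1) (), x :: st.2) fun _ r => (r, st.2)) ([], [])).2

theorem blocks_spec {X O : Type} {b : ℕ} (hb : 0 < b) (x : O) (vs : List X) :
    ∃ N, blocks b x vs = List.replicate N x ∧ vs.length ≤ b * N ∧ b * N ≤ vs.length + b := by
  have h : ∀ (vs : List X) (st : List Unit × List O) (N i : ℕ), st.2 = List.replicate N x →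
      st.1.length < b → b * N = i + st.1.length →
      let st' := vs.foldl (fun (st : List Unit × List O) _ =>
        caseList st.1 (List.replicate (b - 1) (), x :: st.2) fun _ r => (r, st.2)) st
      ∃ N', st'.2 = List.replicate N' x ∧ st'.1.length < b ∧
        b * N' = i + vs.length + st'.1.length := by
    intro vs
    induction vs with
    | nil => exact fun st N i h1 h2 h3 => ⟨N, h1, h2, h3⟩
    | cons v vs ih =>
      rintro ⟨cnt, acc⟩ N i h1 h2 h3
      simp only [List.foldl_cons]
      cases cnt with
      | nil =>
        obtain ⟨N', e1, e2, e3⟩ := ih (List.replicate (b - 1) (), x :: acc) (N + 1) (i + 1)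
          (by simp_all [List.replicate_succ]) (by simp; omega)
          (by simp only [List.length_replicate, List.length_nil] at h3 ⊢; rw [mul_add]; omega)
        exact ⟨N', e1, e2, by rw [e3, List.length_cons, caseList_nil]; ring⟩
      | cons c cnt =>
        obtain ⟨N', e1, e2, e3⟩ := ih (cnt, acc) N (i + 1) h1
          (by simp at h2 ⊢; omega) (by simp at h3 ⊢; omega)
        exact ⟨N', e1, e2, by rw [e3, List.length_cons, caseList_cons]; ring⟩
  obtain ⟨N, e1, e2, e3⟩ := h vs ([], []) 0 0 rfl hb rfl
  exact ⟨N, e1, by omega, by omega⟩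

theorem Poly.blocks {A X O : Type} [Enc A] [Enc X] [Enc O] (b : ℕ) (x : O) {vs : A → List X}
    (hv : Poly vs) : Poly fun a => blocks b x (vs a) := by
  have h1 : Poly fun y : A × (List Unit × List O) × X =>
      KSat.caseList y.2.1.1 (List.replicate (b - 1) (), x :: y.2.1.2) fun _ r => (r, y.2.1.2) :=
    caseList (c := fun z : (A × (List Unit × List O) × X) × Unit × List Unit => (z.2.2, z.1.2.1.2))
      (fst.comp p2) ((const _).pair (cons (const _) (snd.comp p2)))
      (p3.pair (snd.comp (p2.comp fst)))
  exact snd.comp (foldl_of_add hv (const _) h1 (.const (sz (List.replicate (b - 1) ()) + sz x + 1))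
    fun a s e he => by
      obtain ⟨cnt, acc⟩ := s
      cases cnt
      · simp only [caseList_nil, sz_pair, sz_cons, sz_nil]; omega
      · simp only [caseList_cons, sz_pair, sz_cons]; omega)

/-- The program solves the problem for formulas over binary names. -/
theorem exists_search_program (k : ℕ) (hk : 2 ≤ k) (a : ℝ) (ha : 2 * ((k : ℝ) - 1) / k < a) :
    ∃ (p : Program) (D c : ℕ), ∀ F : List (List (Bool × Poly.Name)), (∀ C ∈ F, C.length ≤ k) →
      ∃ (res : Option (List (Bool × Poly.Name))) (T : ℕ), Runs p (enc F) (enc res) T ∧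
        (T : ℝ) ≤ D * (sz F : ℝ) ^ c * a ^ (dedupVars F).length ∧
        (∀ y, res = some y → ∃ α, y = tab α (dedupVars F) ∧ Sat F α) ∧
        (res = none → ∀ α, ¬ Sat F α) := by
  obtain ⟨t, s, d, q, b, S, O, hb, h1, h2, h3, h4, h5⟩ := exists_codes k hk a ha
  have hk2 : (2 : ℝ) ≤ k := by exact_mod_cast hk
  have ha1 : 1 ≤ a := by
    refine le_trans ?_ ha.le
    rw [le_div_iff₀ (by linarith)]; linarith
  have hO : O ≠ [] := by
    obtain ⟨c, hc, -⟩ := h4 (List.replicate b false) (by simp)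
    exact List.ne_nil_of_mem hc
  have hS : List.replicate d 0 ∈ S := h2 _ (by simp) fun j hj => by
    rw [List.eq_of_mem_replicate hj]; omega
  have hB : (words [false, true] (k * t)).map (fun β => (β, ([] : List (List ℕ)))) ≠ [] := by
    rw [Ne, List.map_eq_nil_iff]
    exact List.ne_nil_of_mem (mem_words.2 ⟨List.length_replicate (n := k * t) (a := false), by simp⟩)
  have hW : O ×ˢ words S q ≠ [] := by
    obtain ⟨c, hc⟩ := List.exists_mem_of_ne_nil O hO
    exact List.ne_nil_of_mem (a := (c, List.replicate q (List.replicate d 0)))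
      (List.mem_product.2 ⟨hc, mem_words.2 ⟨by simp, fun w hw => List.eq_of_mem_replicate hw ▸ hS⟩⟩)
  obtain ⟨B, Bs, hBe⟩ := List.exists_cons_of_ne_nil hB
  obtain ⟨W, Ws, hWe⟩ := List.exists_cons_of_ne_nil hW
  have hBl : Bs.length + 1 = 2 ^ (k * t) := by
    have := congrArg List.length hBe
    rw [List.length_map, length_words] at this
    simpa using this.symm
  have hWl : Ws.length + 1 = O.length * S.length ^ q := by
    have := congrArg List.length hWe
    rw [List.length_product, length_words] at this
    simpa using this.symm
  -- The first wheel holds the constantly many guesses for the frozen variables. Every block of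
  -- variables has a wheel with all pairs of a start word and `q` words for its rounds.
  obtain ⟨p, T, ⟨c, hc⟩, hp⟩ := Poly.exhaustive_search
    (V := fun x : List (List (Bool × Poly.Name)) × List (List Bool × List (List ℕ)) =>
      search t x.1 (dedupVars x.1) x.2)
    (fs := fun F => (B, Bs) :: blocks b (W, Ws) (dedupVars F))
    (Poly.search t .fst (Poly.dedupVars .fst) .snd)
    (Poly.cons (.const _) (Poly.blocks b _ (Poly.dedupVars .id))) (fun F => by simp)
  -- The three factors pay for `sz F + 1 ≤ 2 * sz F`, for the first wheel, and for rounding the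
  -- number of variables up to a multiple of `b`.
  refine ⟨p, ⌈(2 : ℝ) ^ c * 2 ^ (k * t) * a ^ b⌉₊, c, fun F hF => ?_⟩
  obtain ⟨hnd, hmem⟩ := dedupVars_spec F
  obtain ⟨N, hN, hN1, hN2⟩ := blocks_spec hb (W, Ws) (dedupVars F)
  obtain ⟨res, r1, r2, r3⟩ := hp F
  have hvars : ∀ C ∈ F, ∀ u ∈ C, u.2 ∈ dedupVars F := fun C hC u hu => (hmem _).2 ⟨C, hC, u, hu, rfl⟩
  refine ⟨res, _, r1, ?_, fun y hy => ?_, fun hn α hα => ?_⟩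
  · rw [hN]
    simp only [List.map_cons, List.map_replicate, List.prod_cons, List.prod_replicate, hBl, hWl]
    push_cast
    have e1 : (T F : ℝ) ≤ 2 ^ c * (sz F : ℝ) ^ c := by
      have h6 : T F ≤ (2 * sz F) ^ c :=
        (hc F).trans (Nat.pow_le_pow_left (by have := sz_pos F; omega) c)
      rw [← mul_pow]
      exact_mod_cast h6
    have e2 : ((O.length : ℝ) * (S.length : ℝ) ^ q) ^ N ≤ a ^ b * a ^ (dedupVars F).length := by
      rw [← pow_add]
      refine (pow_le_pow_left₀ (by positivity) h5 N).trans ?_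
      rw [← pow_mul]
      exact pow_le_pow_right₀ ha1 (by omega)
    calc _ ≤ (2 ^ c * (sz F : ℝ) ^ c) * (2 ^ (k * t) * (a ^ b * a ^ (dedupVars F).length)) := by
          gcongr
      _ = (2 ^ c * 2 ^ (k * t) * a ^ b) * (sz F : ℝ) ^ c * a ^ (dedupVars F).length := by ring
      _ ≤ _ := by gcongr; exact Nat.le_ceil _
  · obtain ⟨σ, hσ⟩ := r2 y hy
    exact sat_of_search hvars hσ
  · obtain ⟨β, r, b1, b2, b3, b4⟩ := exists_choices hvars hF hα h2 hk h1 h3 hnd h4 N hN1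
    refine b4 (r3 hn _ (.cons ?_ ?_))
    · rw [← hBe, List.mem_map]
      exact ⟨β, mem_words.2 ⟨b1, by simp⟩, rfl⟩
    · rw [hN, ← b2]
      clear b2 b4
      induction r with
      | nil => exact .nil
      | cons x r ih =>
        refine .cons ?_ (ih fun y hy => b3 y (by simp [hy]))
        obtain ⟨x1, x2, x3⟩ := b3 x (by simp)
        rw [← hWe]
        exact List.mem_product.2 ⟨x1, mem_words.2 ⟨x2, x3⟩⟩

/-! ### Formulas over natural numbers -/

/-- The literal over binary names. -/
def binLiteral (u : Literal) : Bool × Poly.Name := (u.2, Nat.bits u.1)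

theorem encodeList_map {A B : Type} (f : B → Cell) (g : A → B) (l : List A) :
    encodeList f (l.map g) = encodeList (fun a => f (g a)) l := by
  induction l with
  | nil => rfl
  | cons a l ih => simp [encodeList, ih]

theorem enc_binFormula (L : List (List Literal)) :
    enc (L.map fun C => C.map binLiteral) = encodeFormula L := by
  change encodeList (encodeList enc) _ = encodeList _ L
  rw [encodeList_map]
  congr 1
  funext C
  exact encodeList_map _ _ _

theorem bits_injective : Function.Injective Nat.bits := fun m n h => by
  refine Nat.digits.injective 2 ?_
  rw [Nat.digits_two_eq_bits, Nat.digits_two_eq_bits, h]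

/-! ### Listings and binary names -/

section Listing

variable {F : Finset (Finset Literal)} {L : List (List Literal)} (hL : IsListing L F)

include hL

theorem IsListing.mem_iff {C : Finset Literal} : C ∈ F ↔ ∃ D ∈ L, D.toFinset = C := by
  rw [← hL.2.2]; simp

theorem IsListing.length_le {k : ℕ} (hF : IsKCNF k F) {C : List Literal} (hC : C ∈ L) :
    C.length ≤ k := by
  rw [← List.toFinset_card_of_nodup (hL.1 C hC)]
  exact (hF _ (hL.mem_iff.2 ⟨C, hC, rfl⟩)).2

theorem IsListing.sat_iff (α : ℕ → Bool) (α' : Poly.Name → Bool) (h : ∀ i, α' (Nat.bits i) = α i) :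
    Sat (L.map fun C => C.map binLiteral) α' ↔ Satisfies α F := by
  constructor
  · intro hs C hC
    obtain ⟨D, hD, rfl⟩ := hL.mem_iff.1 hC
    obtain ⟨u, hu, hu'⟩ := hs _ (List.mem_map.2 ⟨D, hD, rfl⟩)
    obtain ⟨v, hv, rfl⟩ := List.mem_map.1 hu
    exact ⟨v, by simpa using hv, by rw [← h]; exact hu'⟩
  · intro hs C hC
    obtain ⟨D, hD, rfl⟩ := List.mem_map.1 hC
    obtain ⟨u, hu, hu'⟩ := hs _ (hL.mem_iff.2 ⟨D, hD, rfl⟩)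
    exact ⟨binLiteral u, List.mem_map.2 ⟨u, by simpa using hu, rfl⟩, (h _).trans hu'⟩

theorem IsListing.exists_vars : ∃ vs : List ℕ, vs.Nodup ∧ vs.toFinset = vbl F ∧
    dedupVars (L.map fun C => C.map binLiteral) = vs.map Nat.bits := by
  obtain ⟨h1, h2⟩ := dedupVars_spec (L.map fun C => C.map binLiteral)
  obtain ⟨vs, hvs⟩ : ∃ vs : List ℕ, vs.map Nat.bits = dedupVars (L.map fun C => C.map binLiteral) := by
    have : dedupVars (L.map fun C => C.map binLiteral) ∈ Set.range (List.map Nat.bits) := by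
      rw [Set.range_list_map]
      intro x hx
      obtain ⟨C, hC, u, hu, rfl⟩ := (h2 x).1 hx
      obtain ⟨D, -, rfl⟩ := List.mem_map.1 hC
      obtain ⟨v, -, rfl⟩ := List.mem_map.1 hu
      exact ⟨v.1, rfl⟩
    exact this
  refine ⟨vs, List.Nodup.of_map _ (hvs ▸ h1), ?_, hvs.symm⟩
  ext i
  have h3 : i ∈ vs ↔ Nat.bits i ∈ dedupVars (L.map fun C => C.map binLiteral) := by
    rw [← hvs, List.mem_map_of_injective bits_injective]
  rw [List.mem_toFinset, h3, h2, vbl]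
  simp only [List.mem_map, Finset.mem_biUnion, Finset.mem_image]
  constructor
  · rintro ⟨_, ⟨D, hD, rfl⟩, u, hu, hi⟩
    obtain ⟨v, hv, rfl⟩ := List.mem_map.1 hu
    exact ⟨_, hL.mem_iff.2 ⟨D, hD, rfl⟩, v, by simpa using hv, bits_injective hi⟩
  · rintro ⟨C, hC, u, hu, rfl⟩
    obtain ⟨D, hD, rfl⟩ := hL.mem_iff.1 hC
    exact ⟨_, ⟨D, hD, rfl⟩, _, List.mem_map.2 ⟨u, by simpa using hu, rfl⟩, rfl⟩

end Listing

theorem size_encodeList_le {A : Type} (f : A → Cell) (l : List A) (M : ℕ)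
    (h : ∀ a ∈ l, (f a).size ≤ M) : (encodeList f l).size ≤ l.length * (M + 1) + 1 := by
  induction l with
  | nil => simp [encodeList, Cell.size]
  | cons a l ih =>
    have h1 := ih fun b hb => h b (by simp [hb])
    have h2 := h a (by simp)
    simp only [encodeList, Cell.size, List.length_cons, add_mul]
    omega

/-- If the variables are `0, …, n - 1`, the input has polynomial length. -/
theorem size_encodeFormula_le {k n : ℕ} {F : Finset (Finset Literal)} {L : List (List Literal)}
    (hF : IsKCNF k F) (hn : vbl F = Finset.range n) (hL : IsListing L F) :
    (encodeFormula L).size ≤ (k + 1) * (2 * n + 1) ^ k * (k * (4 * n + 6) + 2) + 1 := by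
  have hvar : ∀ C ∈ F, ∀ u ∈ C, u.1 < n := fun C hC u hu => by
    rw [← Finset.mem_range, ← hn]
    exact Finset.mem_biUnion.2 ⟨C, hC, Finset.mem_image_of_mem _ hu⟩
  have hlen : L.length ≤ (k + 1) * (2 * n + 1) ^ k := by
    have h1 : L.length = F.card := by
      rw [← hL.2.2, List.toFinset_card_of_nodup hL.2.1, List.length_map]
    -- The clauses are sets of at most `k` of the `2 * n` literals, so for fixed `k` there are only
    -- polynomially many.
    have h2 : F ⊆ (Finset.range (k + 1)).biUnion fun i =>
        (Finset.range n ×ˢ (Finset.univ : Finset Bool)).powersetCard i := by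
      intro C hC
      rw [Finset.mem_biUnion]
      refine ⟨C.card, by simpa [Nat.lt_succ_iff] using (hF C hC).2, Finset.mem_powersetCard.2
        ⟨fun u hu => ?_, rfl⟩⟩
      simpa using hvar C hC u hu
    rw [h1]
    refine (Finset.card_le_card h2).trans (Finset.card_biUnion_le.trans ?_)
    refine (Finset.sum_le_card_nsmul _ _ ((2 * n + 1) ^ k) fun i hi => ?_).trans (by simp)
    rw [Finset.card_powersetCard, Finset.card_product, Finset.card_range, Finset.card_univ,
      Fintype.card_bool]
    calc (n * 2).choose i ≤ (n * 2) ^ i := Nat.choose_le_pow _ _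
      _ ≤ (2 * n + 1) ^ i := Nat.pow_le_pow_left (by omega) _
      _ ≤ _ := Nat.pow_le_pow_right (by omega) (by simpa [Nat.lt_succ_iff] using hi)
  refine (size_encodeList_le _ L (k * (4 * n + 6) + 1) fun C hC => ?_).trans ?_
  · refine (size_encodeList_le _ C (4 * n + 5) fun u hu => ?_).trans ?_
    · have h1 := hvar _ (hL.mem_iff.2 ⟨C, hC, rfl⟩) u (by simpa using hu)
      have h2 : ∀ b, (encodeBit b).size ≤ 3 := sz_bool
      have h3 := size_encodeList_le encodeBit (Nat.bits u.1) 3 fun b _ => h2 b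
      have h4 : (Nat.bits u.1).length ≤ u.1 := by
        rw [Nat.size_eq_bits_len, Nat.size_le]; exact Nat.lt_two_pow_self
      have h5 := h2 u.2
      simp only [encodeLiteral, Cell.size]
      omega
    · gcongr
      exact hL.length_le hF hC
  · gcongr

theorem RunsInInputLength.runsInNumVars {p : Program} {k : ℕ} {a : ℝ} (ha : 0 ≤ a)
    (h : RunsInInputLength p k a) : RunsInNumVars p k a := by
  obtain ⟨C, c, h⟩ := h
  refine ⟨C * ((k + 1) * 2 ^ k * (6 * k + 2) + 1) ^ c, (k + 1) * c, fun n F L t y hF hn hL hp => ?_⟩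
  refine (h F L t y hF hL hp).trans ?_
  rw [hn, Finset.card_range]
  have h1 : (encodeFormula L).size ≤
      ((k + 1) * 2 ^ k * (6 * k + 2) + 1) * (n + 1) ^ (k + 1) := by
    refine (size_encodeFormula_le hF hn hL).trans ?_
    have e1 : (2 * n + 1) ^ k ≤ 2 ^ k * (n + 1) ^ k := by
      rw [← mul_pow]; exact Nat.pow_le_pow_left (by omega) _
    have e2 : k * (4 * n + 6) + 2 ≤ (6 * k + 2) * (n + 1) := by nlinarith
    have e3 : 1 ≤ (n + 1) ^ (k + 1) := Nat.one_le_pow _ _ (by omega)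
    calc _ ≤ (k + 1) * (2 ^ k * (n + 1) ^ k) * ((6 * k + 2) * (n + 1)) + (n + 1) ^ (k + 1) := by
          gcongr
      _ = _ := by ring
  have h2 : ((encodeFormula L).size : ℝ) ≤
      ((k + 1) * 2 ^ k * (6 * k + 2) + 1) * ((n : ℝ) + 1) ^ (k + 1) := by exact_mod_cast h1
  calc (C : ℝ) * ((encodeFormula L).size : ℝ) ^ c * a ^ n
      ≤ C * (((k + 1) * 2 ^ k * (6 * k + 2) + 1) * ((n : ℝ) + 1) ^ (k + 1)) ^ c * a ^ n := by gcongr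
    _ = _ := by push_cast; rw [mul_pow, ← pow_mul]; ring

theorem exists_program (k : ℕ) (hk : 2 ≤ k) (a : ℝ) (ha : 2 * ((k : ℝ) - 1) / k < a) :
    ∃ p : Program, SolvesKSat p k ∧ RunsInInputLength p k a := by
  obtain ⟨p, D, c, hp⟩ := exists_search_program k hk a ha
  have main : ∀ (F : Finset (Finset Literal)) (L : List (List Literal)), IsKCNF k F →
      IsListing L F → ∃ (t : ℕ) (y : Cell), p.Computes (encodeFormula L) t y ∧ IsAnswer F y ∧
        (t : ℝ) ≤ D * ((encodeFormula L).size : ℝ) ^ c * a ^ (vbl F).card := by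
    intro F L hF hL
    obtain ⟨res, T, r1, r2, r3, r4⟩ := hp (L.map fun C => C.map binLiteral) (by
      intro C hC
      obtain ⟨E, hE, rfl⟩ := List.mem_map.1 hC
      rw [List.length_map]
      exact hL.length_le hF hE)
    obtain ⟨vs, v1, v2, v3⟩ := hL.exists_vars
    rw [enc_binFormula] at r1
    obtain ⟨t, s', t1, t2, t3, -⟩ := r1 (fun i => if i = 0 then encodeFormula L else .nil) rfl
    refine ⟨t, enc res, ⟨s', t1, t3⟩, ⟨fun hs => ?_, fun hs => ?_⟩, ?_⟩
    · obtain ⟨α, hα⟩ := hs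
      cases res with
      | none =>
        refine absurd ((hL.sat_iff α (Function.extend Nat.bits α fun _ => false) fun i => ?_).2 hα)
          (r4 rfl _)
        exact bits_injective.extend_apply _ _ _
      | some y =>
        obtain ⟨α', rfl, h2⟩ := r3 y rfl
        refine ⟨fun i => α' (Nat.bits i), (hL.sat_iff _ α' fun i => rfl).1 h2, vs, v1, v2, ?_⟩
        change Cell.cons .nil (encodeList enc (tab α' _)) = _
        rw [v3, tab, List.map_map, encodeList_map, encodeList_map]
        rfl
    · cases res with
      | none => rfl
      | some y =>
        obtain ⟨α', -, h2⟩ := r3 y rfl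
        exact absurd ⟨fun i => α' (Nat.bits i), (hL.sat_iff _ α' fun i => rfl).1 h2⟩ hs
    · have h1 : (dedupVars (L.map fun C => C.map binLiteral)).length = (vbl F).card := by
        rw [v3, List.length_map, ← v2, List.toFinset_card_of_nodup v1]
      have h2 : sz (L.map fun C => C.map binLiteral) = (encodeFormula L).size := by
        rw [sz, enc_binFormula]
      rw [← h1, ← h2]
      exact le_trans (by exact_mod_cast t2) r2
  refine ⟨p, fun F L hF hL => ?_, D, c, fun F L t y hF hL hty => ?_⟩
  · obtain ⟨t, y, h1, h2, -⟩ := main F L hF hL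
    exact ⟨t, y, h1, h2⟩
  · obtain ⟨t', y', ⟨s', h1, -⟩, -, h3⟩ := main F L hF hL
    obtain ⟨s, h4, -⟩ := hty
    -- Any halting run on this input is the one constructed above, so its time bound applies.
    rw [(h4.deterministic h1).1]
    exact h3

end KSat

theorem theorem3 (k : ℕ) (hk : 2 ≤ k) (ε : ℝ) (hε : 0 < ε) :
    ∃ p : KSat.Program,
      KSat.SolvesKSat p k ∧
      KSat.RunsInInputLength p k (2 * ((k : ℝ) - 1) / (k : ℝ) + ε) ∧
      KSat.RunsInNumVars p k (2 * ((k : ℝ) - 1) / (k : ℝ) + ε) := by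
  obtain ⟨p, h1, h2⟩ := KSat.exists_program k hk (2 * ((k : ℝ) - 1) / (k : ℝ) + ε) (by linarith)
  refine ⟨p, h1, h2, h2.runsInNumVars ?_⟩
  have hk1 : (2 : ℝ) ≤ k := by exact_mod_cast hk
  have : 0 ≤ 2 * ((k : ℝ) - 1) / (k : ℝ) := div_nonneg (by linarith) (by linarith)
  linarith
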